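/- Let $G$ be a real Lie group of dimension $n$ with Lie algebra $\mathfrak g$ (e.g. a simply connected one), let $b_1,\dots,b_n$ be a basis of $\mathfrak g$, orthonormal for a scalar product, with $[b_i,b_j]=\sum_k c_{ij}^k b_k$, and let $B$ be a left-invariant closed $2$-form on $G$. Then $\alpha_B(u,v)=B_e(u,v)$ is a $2$-cocycle on $\mathfrak g$. Let $\mathfrak g_B=\mathfrak g\oplus\mathbb R w$ be the central extension with bracket $[u,v]_{\mathfrak g_B}=[u,v]_{\mathfrak g}+\alpha_B(u,v)w$, $w$ central. Let $x_1,\dots,x_n$ and $x_1,\dots,x_{n+1}$ be the coordinates on $\mathfrak g^*$ and $\mathfrak g_B^*$ given by $b_1,\dots,b_n$ and $b_1,\dots,b_n,w$, with the Lie–Poisson brackets $\{x_i,x_j\}=\sum_k c_{ij}^kx_k$ defined by the structure constants of $\mathfrak g$ and of $\mathfrak g_B$ respectively. Put $B_{ik}=B_e(b_i,b_k)$, $H=\frac12\sum_{i=1}^n x_i^2$, $\widehat H=H+\frac12x_{n+1}^2$. A Hamiltonian $K$ on $T^*G$ together with a closed $2$-form $F$ on $G$ (the magnetic field) defines the system $\dot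 f=\{f,K\}_F$, where $\{q^i,p_k\}_F=\delta^i_k$, $\{q^i,q^k\}_F=0$, $\{p_i,p_k\}_F=F_{ik}(q)$ in canonical coordinates. Its Euler equations are its reduction by left translations, i.e. its image under $T^*G\to\mathfrak g^*$, $x_i(q,p)=-\langle p,E_i(q)\rangle$, with $E_i$ the left-invariant field of $b_i$ (the sign makes the image of the canonical bracket equal to the above Lie–Poisson bracket). The same conventions are used for other Lie groups. The magnetic geodesic flow on $G$ is the system with $K=\frac12\sum_i\langle p,E_i(q)\rangle^2$. The system $\dot x_i=\{x_i,H\}$ on $\mathbb R^N$ with a Poisson tensor $P$ is called integrable if for some $s,k\ge0$ it has $C^\infty$ first integrals $f_1,\dots,f_s,h_1,\dots,h_k$ on $\mathbb R^N$, functionally independent almost everywhere, with all $\{f_i,f_j\}=\{f_i,h_j\}=0$, and $2s+k=2N-\operatorname{rank}P$ almost everywhere ($k=0$ is Liouville integrability, $k>0$ is non-commutative integrability with defect $k$). The Euler equations $\dot x_i=\{x_i,\widehat H\}_{\mathfrak g_B}$ on $\mathfrak g_B^*$ read $$\dot x_i=\{x_i,H\}_{\mathfrak g}+x_{n+1}\sum_{k=1}^nB_{ik}x_k\quad(i=1,\dots,n),\qquad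 \dot x_{n+1}=0,\qquad(*)$$ and the following hold. 1) The equations $(*)$ coincide with the equations $\dot x_i=\{x_i,H\}_{\mathfrak g_B}$, $i=1,\dots,n+1$. For every Lie group $G_B$ with Lie algebra $\mathfrak g_B$ (one exists if $G$ is simply connected), $(*)$ are the Euler equations of the geodesic flow of the left-invariant Riemannian metric on $G_B$ with orthonormal basis $b_1,\dots,b_n,w$ (reduced Hamiltonian $\widehat H$), and also the Euler equations of the normal geodesic flow of the left-invariant sub-Riemannian metric on $G_B$ (reduced Hamiltonian $H$) whose distribution is spanned by the left-invariant fields of $b_1,\dots,b_n$, as an orthonormal frame. This distribution is non-integrable if $B\ne0$. 2) For each $c\in\mathbb R$ the Euler equations of the magnetic geodesic flow on $G$ with the magnetic field $cB$ are the equations $\dot x_i=\{x_i,H\}_c$ on $\mathfrak g^*$, where $\{x_i,x_j\}_c=\sum_kc_{ij}^kx_k+cB_{ij}$, and they are the restriction of $(*)$ to $x_{n+1}=c$: a curve in $\mathfrak g_B^*$ defined on an interval solves $(*)$ if and only if, for some constant $c$, $x_{n+1}\equiv c$ and $(x_1,\dots,x_n)$ solves the Euler equations of the magnetic geodesic flow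 with field $cB$. 3) If $(*)$ is integrable (with defect $k$), then the Euler equations of the magnetic geodesic flow on $G$ with field $cB$ are integrable (with the same defect $k$) for almost every $c\in\mathbb R$; in particular, Liouville integrability of $(*)$ implies Liouville integrability for almost every $c$. -/

import Mathlib

open scoped Manifold ContDiff
open LieModule.Cohomology MeasureTheory

/-! ### Hamiltonian systems on `ℝ^N` with a given Poisson tensor -/

/-- A bivector field on `ℝ^N`, through its matrix `P x i j = {x_i, x_j}(x)`. -/
abbrev PoissonTensor (N : ℕ) := (Fin N → ℝ) → Matrix (Fin N) (Fin N) ℝ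

/-- The bracket `{f, g} = ∑_{i,j} ∂f/∂x_i ∂g/∂x_j {x_i, x_j}`. -/
noncomputable def PoissonTensor.bracket {N : ℕ} (P : PoissonTensor N) (f g : (Fin N → ℝ) → ℝ)
    (x : Fin N → ℝ) : ℝ :=
  ∑ i, ∑ j, fderiv ℝ f x (Pi.single i 1) * fderiv ℝ g x (Pi.single j 1) * P x i j

/-- The right-hand side of the Euler equations `ẋ_i = {x_i, H}`. -/
noncomputable def PoissonTensor.eulerField {N : ℕ} (P : PoissonTensor N) (H : (Fin N → ℝ) → ℝ)
    (x : Fin N → ℝ) : Fin N → ℝ :=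
  fun i => P.bracket (fun y => y i) H x

/-- `γ` solves the Euler equations `ẋ_i = {x_i, H}` on the time set `J`. -/
def PoissonTensor.IsSolutionOn {N : ℕ} (P : PoissonTensor N) (H : (Fin N → ℝ) → ℝ)
    (γ : ℝ → Fin N → ℝ) (J : Set ℝ) : Prop :=
  ∀ t ∈ J, HasDerivWithinAt γ (P.eulerField H (γ t)) J t

/-- Integrability (by globally defined `C^∞` first integrals) of the Hamiltonian system
`ẋ_i = {x_i, H}`. There are first integrals `f_1, …, f_s, h_1, …, h_k`, functionally independent
almost everywhere, the `f_i` being in involution with all of them, and their number is complete: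
`s + (s + k) = 2 N - rank P` almost everywhere. For `k = 0` this is Liouville integrability
(`s = N - (rank P) / 2` commuting independent integrals, Casimir functions included); for `k > 0`
it is non-commutative integrability. -/
def PoissonTensor.IsIntegrable {N : ℕ} (P : PoissonTensor N) (H : (Fin N → ℝ) → ℝ)
    (k : ℕ) : Prop :=
  ∃ (s : ℕ) (f : Fin s → (Fin N → ℝ) → ℝ) (h : Fin k → (Fin N → ℝ) → ℝ),
    (∀ i, ContDiff ℝ ∞ (f i)) ∧ (∀ i, ContDiff ℝ ∞ (h i)) ∧
    (∀ i x, P.bracket (f i) H x = 0) ∧ (∀ i x, P.bracket (h i) H x = 0) ∧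
    (∀ i j x, P.bracket (f i) (f j) x = 0) ∧ (∀ i j x, P.bracket (f i) (h j) x = 0) ∧
    ∀ᵐ x : Fin N → ℝ,
      LinearIndependent ℝ (fun i : Fin s ⊕ Fin k => fderiv ℝ (Sum.elim f h i) x) ∧
      2 * s + k + (P x).rank = 2 * N

/-- `H = ½ ∑ x_i²`. -/
noncomputable def sqHamiltonian (N : ℕ) (x : Fin N → ℝ) : ℝ := (1 / 2) * ∑ i, x i ^ 2

/-! ### Lie–Poisson brackets and central extensions -/

/-- The Lie–Poisson tensor `{x_i, x_j} = ∑_k c_{ij}^k x_k` on the dual of a Lie algebra with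
basis `b`, in the coordinates `x_i` given by the basis vectors `b i`, where
`[b_i, b_j] = ∑_k c_{ij}^k b_k`. -/
noncomputable def liePoisson {L : Type*} [LieRing L] [LieAlgebra ℝ L] {N : ℕ} (b : Module.Basis (Fin N) ℝ L) :
    PoissonTensor N :=
  fun x => Matrix.of fun i j => ∑ k, b.repr ⁅b i, b j⁆ k * x k

/-- The trivial action of a Lie algebra on `ℝ`. -/
@[reducible] def trivialLieRingModule (L : Type*) [LieRing L] : LieRingModule L ℝ where
  bracket _ _ := 0
  add_lie _ _ _ := by simp
  lie_add _ _ _ := by simp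
  leibniz_lie _ _ _ := by simp

attribute [local instance] trivialLieRingModule

/-- The trivial action of a real Lie algebra on `ℝ` is linear. -/
theorem trivialLieModule (L : Type*) [LieRing L] [LieAlgebra ℝ L] : LieModule ℝ L ℝ where
  smul_lie _ _ _ := by
    change (0 : ℝ) = _ • (0 : ℝ)
    simp
  lie_smul _ _ _ := by
    change (0 : ℝ) = _ • (0 : ℝ)
    simp

attribute [local instance] trivialLieModule

/-- The basis `(b_1, 0), …, (b_n, 0), (0, 1)` of the central extension of `L` by `ℝ` with bracket
`[(u, s), (v, t)] = ([u, v], α(u, v))`. -/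
noncomputable def centralBasis {L : Type*} [LieRing L] [LieAlgebra ℝ L] {n : ℕ}
    (b : Module.Basis (Fin n) ℝ L) (α : twoCocycle ℝ L ℝ) :
    Module.Basis (Fin (n + 1)) ℝ (LieAlgebra.ofTwoCocycle α) :=
  Module.Basis.ofEquivFun
    { toFun := fun y => Fin.snoc (α := fun _ => ℝ) (fun i => b.repr y.carrier.1 i) y.carrier.2
      invFun := fun w => LieAlgebra.ofProd α (∑ i : Fin n, w i.castSucc • b i, w (Fin.last n))
      map_add' := fun y z => by
        have hh : (y + z).carrier = y.carrier + z.carrier := rfl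
        funext i
        refine Fin.lastCases ?_ (fun j => ?_) i <;> simp [hh]
      map_smul' := fun r y => by
        have hh : (r • y).carrier = r • y.carrier := rfl
        funext i
        refine Fin.lastCases ?_ (fun j => ?_) i <;> simp [hh]
      left_inv := fun y => by
        rcases y with ⟨u, s⟩
        simp [LieAlgebra.ofProd, b.sum_repr]
      right_inv := fun w => by
        funext i
        refine Fin.lastCases ?_ (fun j => ?_) i
        · simp [LieAlgebra.ofProd]
        · simp [LieAlgebra.ofProd, Finsupp.single_apply] }

/-! ### Lie groups, left-invariant forms, distributions -/

/-- A smooth real Lie group has the regularity used to define its Lie algebra. -/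
instance instLieGroupMinSmoothness {n : ℕ} {G : Type*} [TopologicalSpace G]
    [ChartedSpace (EuclideanSpace ℝ (Fin n)) G] [Group G] [LieGroup (𝓡 n) ∞ G] :
    LieGroup (𝓡 n) (minSmoothness ℝ 3) G :=
  LieGroup.of_le (n := ∞) (by simp only [minSmoothness_of_isRCLikeNormedField]; exact ENat.LEInfty.out)

section Manifold

variable {n : ℕ} {G : Type*} [TopologicalSpace G] [ChartedSpace (EuclideanSpace ℝ (Fin n)) G]

/-- A field of alternating bilinear forms on the tangent spaces. -/
abbrev TwoFormField (n : ℕ) (G : Type*) [TopologicalSpace G]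
    [ChartedSpace (EuclideanSpace ℝ (Fin n)) G] :=
  (q : G) → TangentSpace (𝓡 n) q [⋀^Fin 2]→L[ℝ] ℝ

/-- Smooth vector fields. -/
def IsSmoothField [IsManifold (𝓡 n) ∞ G] (X : (q : G) → TangentSpace (𝓡 n) q) : Prop :=
  ContMDiff (𝓡 n) (𝓡 n).tangent ∞ (fun q => (⟨q, X q⟩ : TangentBundle (𝓡 n) G))

/-- The derivative of a function at `q` along a tangent vector `u`. -/
noncomputable def dirDeriv (f : G → ℝ) (q : G) (u : TangentSpace (𝓡 n) q) : ℝ :=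
  mfderiv (𝓡 n) 𝓘(ℝ, ℝ) f q u

/-- `dB = 0`, where `dB` is computed by the invariant formula
`dB(X, Y, Z) = X B(Y, Z) - Y B(X, Z) + Z B(X, Y) - B([X, Y], Z) + B([X, Z], Y) - B([Y, Z], X)`. -/
def TwoFormField.IsClosed [IsManifold (𝓡 n) ∞ G] (B : TwoFormField n G) : Prop :=
  ∀ X Y Z : (q : G) → TangentSpace (𝓡 n) q,
    IsSmoothField X → IsSmoothField Y → IsSmoothField Z → ∀ q : G,
      dirDeriv (fun r => B r ![Y r, Z r]) q (X q)
        - dirDeriv (fun r => B r ![X r, Z r]) q (Y q)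
        + dirDeriv (fun r => B r ![X r, Y r]) q (Z q)
        - B q ![VectorField.mlieBracket (𝓡 n) X Y q, Z q]
        + B q ![VectorField.mlieBracket (𝓡 n) X Z q, Y q]
        - B q ![VectorField.mlieBracket (𝓡 n) Y Z q, X q] = 0

/-- `B` is invariant under all left translations. -/
def TwoFormField.IsLeftInvariant [Group G] (B : TwoFormField n G) : Prop :=
  ∀ (g q : G) (u v : TangentSpace (𝓡 n) q),
    B (g * q) ![mfderiv (𝓡 n) (𝓡 n) (fun r => g * r) q u,
      mfderiv (𝓡 n) (𝓡 n) (fun r => g * r) q v] = B q ![u, v]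

/-- The left-invariant distribution spanned by the left-invariant fields of the vectors `v a`. -/
noncomputable def leftDistribution [Group G] {ι : Type*} (v : ι → GroupLieAlgebra (𝓡 n) G) (q : G) :
    Submodule ℝ (TangentSpace (𝓡 n) q) :=
  Submodule.span ℝ (Set.range fun a => mulInvariantVectorField (v a) q)

/-- A distribution is involutive (equivalently, by Frobenius, integrable) if brackets of smooth
fields tangent to it are tangent to it. -/
def IsInvolutive [IsManifold (𝓡 n) ∞ G] (D : (q : G) → Submodule ℝ (TangentSpace (𝓡 n) q)) : Prop :=
  ∀ X Y : (q : G) → TangentSpace (𝓡 n) q, IsSmoothField X → IsSmoothField Y →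
    (∀ q, X q ∈ D q) → (∀ q, Y q ∈ D q) → ∀ q, VectorField.mlieBracket (𝓡 n) X Y q ∈ D q

/-! ### The cotangent bundle and its (magnetic) Poisson bracket -/

/-- Points `(q, p)` of the cotangent bundle. -/
structure Cotangent (n : ℕ) (G : Type*) [TopologicalSpace G]
    [ChartedSpace (EuclideanSpace ℝ (Fin n)) G] where
  /-- the base point `q` -/
  base : G
  /-- the momentum `p`, a covector at `q` -/
  mom : TangentSpace (𝓡 n) base →L[ℝ] ℝ

/-- The coordinate vector `∂/∂q^i` at `q` of the preferred chart at `q`. -/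
noncomputable def coordVector (q : G) (i : Fin n) : TangentSpace (𝓡 n) q :=
  (mfderiv (𝓡 n) 𝓘(ℝ, EuclideanSpace ℝ (Fin n)) (extChartAt (𝓡 n) q) q).inverse
    (EuclideanSpace.single i 1)

/-- The covector `∑_i p_i dq^i` with coordinates `(q^1, …, q^n, p_1, …, p_n)` in the chart at
`q₀`. -/
noncomputable def Cotangent.ofCoords (q₀ : G)
    (y : EuclideanSpace ℝ (Fin n) × EuclideanSpace ℝ (Fin n)) : Cotangent n G where
  base := (extChartAt (𝓡 n) q₀).symm y.1
  mom := (innerSL ℝ y.2).comp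
    (mfderiv (𝓡 n) 𝓘(ℝ, EuclideanSpace ℝ (Fin n)) (extChartAt (𝓡 n) q₀)
      ((extChartAt (𝓡 n) q₀).symm y.1))

/-- The canonical coordinates `(q^i, p_i)` of a point `z` in the chart at its base point. -/
noncomputable def Cotangent.coords (z : Cotangent n G) :
    EuclideanSpace ℝ (Fin n) × EuclideanSpace ℝ (Fin n) :=
  (extChartAt (𝓡 n) z.base z.base, WithLp.toLp 2 fun i => z.mom (coordVector z.base i))

/-- The partial derivative `∂F/∂q^i` at `z` in canonical coordinates. -/
noncomputable def Cotangent.dq (F : Cotangent n G → ℝ) (z : Cotangent n G) (i : Fin n) : ℝ :=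
  fderiv ℝ (fun y => F (Cotangent.ofCoords z.base y)) z.coords (EuclideanSpace.single i 1, 0)

/-- The partial derivative `∂F/∂p_i` at `z` in canonical coordinates. -/
noncomputable def Cotangent.dp (F : Cotangent n G → ℝ) (z : Cotangent n G) (i : Fin n) : ℝ :=
  fderiv ℝ (fun y => F (Cotangent.ofCoords z.base y)) z.coords (0, EuclideanSpace.single i 1)

/-- The Poisson bracket on the cotangent bundle in the magnetic field `B`:
`{q^i, p_k} = δ^i_k`, `{q^i, q^k} = 0`, `{p_i, p_k} = B_{ik}(q)`. For `B = 0` it is the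
canonical one. -/
noncomputable def magneticBracket (B : TwoFormField n G) (F K : Cotangent n G → ℝ) (z : Cotangent n G) : ℝ :=
  ∑ i, (Cotangent.dq F z i * Cotangent.dp K z i - Cotangent.dp F z i * Cotangent.dq K z i)
    + ∑ i, ∑ k, B z.base ![coordVector z.base i, coordVector z.base k]
        * Cotangent.dp F z i * Cotangent.dp K z k

/-- The Hamiltonian `½ ∑_a ⟨p, V_a(q)⟩²` of the left-invariant (sub-)Riemannian metric for which
the left-invariant fields `V_a` of the linearly independent vectors `v a` form an orthonormal frame
(of the distribution that they span). If the `v a` are a basis of the Lie algebra, this is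
`½ ∑ g^{ik}(q) p_i p_k` for a left-invariant Riemannian metric; in general its flow is the normal
sub-Riemannian geodesic flow. -/
noncomputable def frameHamiltonian [Group G] {m : ℕ} (v : Fin m → GroupLieAlgebra (𝓡 n) G)
    (z : Cotangent n G) : ℝ :=
  (1 / 2) * ∑ a, z.mom (mulInvariantVectorField (v a) z.base) ^ 2

/-- The left trivialization `T^*G → 𝔤^* ≅ ℝ^n`, `x_i(q, p) = -⟨p, E_i(q)⟩`, with `E_i` the
left-invariant field of the basis vector `b i`. The sign is the one for which the bracket with
`{q^i, p_k} = δ^i_k` is mapped to `{x_i, x_j} = +∑_k c_{ij}^k x_k`. -/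
noncomputable def leftMomentum [Group G] (b : Module.Basis (Fin n) ℝ (GroupLieAlgebra (𝓡 n) G))
    (z : Cotangent n G) : Fin n → ℝ :=
  fun i => -z.mom (mulInvariantVectorField (b i) z.base)

/-- Reduction by left translations: the left trivialization maps the Hamiltonian system on `T^*G`
with Hamiltonian `K` and magnetic field `B` to the system on `𝔤^* ≅ ℝ^n` with Poisson tensor `P`
and Hamiltonian `H`. In particular `d f/dt = {f, H}` are the Euler equations of the flow of `K`. -/
def ReducesTo [Group G] (b : Module.Basis (Fin n) ℝ (GroupLieAlgebra (𝓡 n) G))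
    (B : TwoFormField n G) (K : Cotangent n G → ℝ) (P : PoissonTensor n)
    (H : (Fin n → ℝ) → ℝ) : Prop :=
  (∀ f g : (Fin n → ℝ) → ℝ, ContDiff ℝ ∞ f → ContDiff ℝ ∞ g → ∀ z : Cotangent n G,
    magneticBracket B (fun w => f (leftMomentum b w)) (fun w => g (leftMomentum b w)) z
      = P.bracket f g (leftMomentum b z)) ∧
  (∀ z, K z = H (leftMomentum b z)) ∧ Function.Surjective (leftMomentum b)

/-- The magnetic Lie–Poisson tensor `{x_i, x_j} = ∑_k c_{ij}^k x_k + c B_{ij}` on `𝔤^* ≅ ℝ^n`. -/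
noncomputable def magneticLiePoisson [Group G] [LieGroup (𝓡 n) ∞ G]
    (b : Module.Basis (Fin n) ℝ (GroupLieAlgebra (𝓡 n) G)) (B : TwoFormField n G) (c : ℝ) :
    PoissonTensor n :=
  fun x => liePoisson b x + Matrix.of fun i j => c * B 1 ![b i, b j]

end Manifold

/-- `Ĥ = H + x_{n+1}² / 2` on `ℝ^{n+1}`, `H = ½ ∑_{i ≤ n} x_i²`. -/
noncomputable def extHamiltonian (n : ℕ) (x : Fin (n + 1) → ℝ) : ℝ :=
  sqHamiltonian n (fun i => x i.castSucc) + x (Fin.last n) ^ 2 / 2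

/-- `H = ½ ∑_{i ≤ n} x_i²` as a function on `ℝ^{n+1}`. -/
noncomputable def horHamiltonian (n : ℕ) (x : Fin (n + 1) → ℝ) : ℝ :=
  sqHamiltonian n (fun i => x i.castSucc)

/-! ### Functionally independent integrals of a degenerate Poisson tensor -/

/-! In the central extension the structure constants along `w` are the numbers `B_ij`, so the
bracket of `x_i` and `x_j` there is the Lie–Poisson one plus `x_{n+1} B_ij`, and `x_{n+1}` is a
Casimir function. The extended Poisson tensor is thus a stack of the magnetic tensors with field
`cB`, one on each hyperplane `x_{n+1} = c`. This is recorded in `PoissonTensor.IsFamily`. The form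
of the equations, the equality of the flows of the two Hamiltonians (they differ by a function of
the Casimir) and the description of the solutions follow from it.

That these are Euler equations is a computation in canonical coordinates: momenta of vector fields
satisfy `{-⟨p,X⟩, -⟨p,Y⟩} = -⟨p,[X,Y]⟩ + B(X,Y)` (`canonical_bracket_comp_momentum`). For
left-invariant fields the right-hand side is an affine function of the momenta. Closedness of `B`,
tested on left-invariant fields, is the cocycle identity. The distribution is not involutive because
`[b_i,b_j]` has `w`-component `B_ij`.

Integrability is the delicate point. On a hyperplane the complete count drops from `2(n+1)` to `2n`
at equal rank, so exactly one commuting integral must be lost. A dimension count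
(`mem_span_of_complete`) puts the differential of the Casimir in the span of the `df_i`, so
restriction to a hyperplane creates exactly one linear relation, and it involves only the `f_i`.
Which `f_i` may be dropped can depend on the point. Therefore the `f_i` are first sheared to `f_j -
ν_j f_last` with constants `ν_j`; at almost every point almost every `ν` works
(`linearIndependent_shear`, `ae_affine_ne_zero`). Fubini gives one `ν` good almost everywhere, and
Fubini again gives almost every `c`. -/

/-- If a family `u, w` of covectors is complete for the bilinear form `M`, then `span u` contains
the covectors in the two-sided kernel of `M`. -/
theorem mem_span_of_complete {N s k : ℕ} (M : Matrix (Fin N) (Fin N) ℝ)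
    (u : Fin s → Fin N → ℝ) (w : Fin k → Fin N → ℝ)
    (hli : LinearIndependent ℝ (Sum.elim u w))
    (huu : ∀ i j, u i ⬝ᵥ M.mulVec (u j) = 0) (huw : ∀ i j, u i ⬝ᵥ M.mulVec (w j) = 0)
    (hrank : 2 * s + k + M.rank = 2 * N) (e : Fin N → ℝ) (he : Matrix.vecMul e M = 0) :
    e ∈ Submodule.span ℝ (Set.range u) := by
  by_contra hmem
  have hu : LinearIndependent ℝ u := by simpa using hli.comp Sum.inl Sum.inl_injective
  have hU : LinearIndependent ℝ (fun o : Option (Fin s) => Option.casesOn' o e u) :=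
    linearIndependent_option'.2 ⟨hu, hmem⟩
  set U : Matrix (Option (Fin s)) (Fin N) ℝ :=
    Matrix.of fun o => Option.casesOn' o e u with hUdef
  have hUrank : U.rank = s + 1 := by
    have := LinearIndependent.rank_matrix (M := U) hU
    simpa using this
  -- If `e` were outside `span u`, the kernel of `U` would have dimension `N - s - 1`. It contains
  -- `M W`, whose dimension is at least `(s + k) - (N - rank M) = N - s`: a contradiction.
  set W := Submodule.span ℝ (Set.range (Sum.elim u w)) with hW
  have hWdim : Module.finrank ℝ W = s + k := by
    rw [hW, finrank_span_eq_card hli]; simp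
  have hle : W.map M.mulVecLin ≤ LinearMap.ker U.mulVecLin := by
    rw [hW, Submodule.map_span, Submodule.span_le]
    rintro _ ⟨_, ⟨i, rfl⟩, rfl⟩
    rw [SetLike.mem_coe, LinearMap.mem_ker]
    funext o
    rcases o with _ | o
    · change e ⬝ᵥ M.mulVec _ = 0
      rw [Matrix.dotProduct_mulVec, he, zero_dotProduct]
    · rcases i with i | i
      · exact huu o i
      · exact huw o i
  have h1 := Submodule.finrank_mono hle
  have h2 := LinearMap.finrank_range_add_finrank_ker U.mulVecLin
  have h3 := LinearMap.finrank_range_add_finrank_ker M.mulVecLin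
  have h4 := LinearMap.finrank_range_add_finrank_ker (M.mulVecLin.domRestrict W)
  have h5 : Module.finrank ℝ (LinearMap.ker (M.mulVecLin.domRestrict W)) ≤
      Module.finrank ℝ (LinearMap.ker M.mulVecLin) := by
    rw [LinearMap.ker_domRestrict]
    exact LinearMap.finrank_le_finrank_of_injective
      (f := (W.subtype.comp (Submodule.subtype _)).codRestrict (LinearMap.ker M.mulVecLin)
        (fun x => x.2)) (by
          intro x y hxy
          have := congrArg Subtype.val hxy
          exact Subtype.ext (Subtype.ext this))
  rw [LinearMap.range_domRestrict, hWdim] at h4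
  have h6 : Module.finrank ℝ (LinearMap.range U.mulVecLin) = s + 1 := hUrank
  have h7 : Module.finrank ℝ (LinearMap.range M.mulVecLin) = M.rank := rfl
  simp only [Module.finrank_fintype_fun_eq_card, Fintype.card_fin] at h2 h3
  omega

/-- Dropping one covector after a generic shear keeps a family independent modulo `e`. -/
theorem linearIndependent_shear {V U : Type*} [AddCommGroup V] [Module ℝ V] [AddCommGroup U]
    [Module ℝ U] {s k : ℕ} (u : Fin (s + 1) → V) (w : Fin k → V)
    (hli : LinearIndependent ℝ (Sum.elim u w)) (a : Fin (s + 1) → ℝ) (φ : V →ₗ[ℝ] U)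
    (hφ : ∀ v, φ v = 0 → ∃ t : ℝ, v = t • ∑ i, a i • u i) (ν : Fin s → ℝ)
    (hν : a (Fin.last s) + ∑ j, ν j * a j.castSucc ≠ 0) :
    LinearIndependent ℝ (Sum.elim (fun j : Fin s => φ (u j.castSucc - ν j • u (Fin.last s)))
      (fun j => φ (w j))) := by
  rw [Fintype.linearIndependent_iff] at hli ⊢
  intro g hg
  simp only [Fintype.sum_sum_type, Sum.elim_inl, Sum.elim_inr] at hg hli
  simp only [← map_smul, ← map_sum, ← map_add] at hg
  obtain ⟨t, ht⟩ := hφ _ hg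
  -- A relation between the images lifts to a relation modulo `∑ a_i u_i`. Comparing coefficients
  -- gives `g_j = t a_j` and `-∑ g_j ν_j = t a_last`, hence `t (a_last + ∑ ν_j a_j) = 0`.
  have key := hli (Sum.elim (Fin.snoc (α := fun _ => ℝ) (fun j => g (Sum.inl j) - t * a j.castSucc)
    (-∑ j, g (Sum.inl j) * ν j - t * a (Fin.last s))) (fun j => g (Sum.inr j))) (by
      simp only [Sum.elim_inl, Sum.elim_inr, Fin.sum_univ_castSucc, Fin.snoc_castSucc,
        Fin.snoc_last]
      rw [Fin.sum_univ_castSucc] at ht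
      rw [← sub_eq_zero] at ht
      rw [← ht]
      simp only [sub_smul, smul_sub, Finset.sum_sub_distrib, smul_smul, smul_add, neg_smul,
        Finset.sum_smul, Finset.smul_sum]
      abel)
  have h0 := key (Sum.inl (Fin.last s))
  have h1 : ∀ j : Fin s, g (Sum.inl j) = t * a j.castSucc := fun j => by
    have := key (Sum.inl j.castSucc)
    simp only [Sum.elim_inl, Fin.snoc_castSucc] at this
    linarith
  simp only [Sum.elim_inl, Fin.snoc_last, h1] at h0
  have ht0 : t = 0 := by
    have : t * (a (Fin.last s) + ∑ j, ν j * a j.castSucc) = 0 := by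
      rw [mul_add, Finset.mul_sum]
      have e : ∑ j, t * (ν j * a j.castSucc) = ∑ j, t * a (Fin.castSucc j) * ν j :=
        Finset.sum_congr rfl fun j _ => by ring
      rw [e]; linarith
    exact (mul_eq_zero.1 this).resolve_right hν
  rintro (j | j)
  · rw [h1, ht0, zero_mul]
  · simpa using key (Sum.inr j)

/-- A nontrivial affine function vanishes almost nowhere. -/
theorem ae_affine_ne_zero {s : ℕ} (a : Fin (s + 1) → ℝ) (ha : a ≠ 0) :
    ∀ᵐ ν : Fin s → ℝ, a (Fin.last s) + ∑ j, ν j * a j.castSucc ≠ 0 := by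
  -- With a nonzero linear coefficient the zero set is a proper affine subspace, hence null;
  -- otherwise the function is the nonzero constant `a_last`. The second case includes `s = 0`.
  by_cases h : ∃ j : Fin s, a j.castSucc ≠ 0
  · obtain ⟨j, hj⟩ := h
    let ℓ : (Fin s → ℝ) →ₗ[ℝ] ℝ := ∑ i, a i.castSucc • LinearMap.proj i
    have hℓ : ∀ ν, ℓ ν = ∑ j, ν j * a j.castSucc := fun ν => by
      simp [ℓ, LinearMap.sum_apply, mul_comm]
    let S : AffineSubspace ℝ (Fin s → ℝ) :=
      (AffineSubspace.mk' (-a (Fin.last s)) (⊥ : Submodule ℝ ℝ)).comap ℓ.toAffineMap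
    have hS : ∀ ν, ν ∈ S ↔ a (Fin.last s) + ∑ j, ν j * a j.castSucc = 0 := fun ν => by
      simp only [S, AffineSubspace.mem_comap, LinearMap.coe_toAffineMap, AffineSubspace.mem_mk',
        Submodule.mem_bot, vsub_eq_sub, hℓ]
      constructor <;> intro h <;> linarith
    have hne : S ≠ ⊤ := by
      intro htop
      have h0 := (hS 0).1 (htop ▸ AffineSubspace.mem_top _ _ _)
      have h1 := (hS (Pi.single j 1)).1 (htop ▸ AffineSubspace.mem_top _ _ _)
      simp [Pi.single_apply] at h0 h1
      rw [h0, zero_add] at h1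
      exact hj h1
    have := Measure.addHaar_affineSubspace volume S hne
    rw [ae_iff]
    convert this using 2
    ext ν
    simp [hS]
  · push Not at h
    refine Filter.Eventually.of_forall fun ν => ?_
    simp only [h, mul_zero, Finset.sum_const_zero, add_zero]
    intro h'
    exact ha (funext fun i => Fin.lastCases h' h i)

/-- Passes between `fderiv` of a `Sum.elim` and `Sum.elim` of the derivatives, which agree by `rfl`
only after a case split on the index. -/
theorem linearIndependent_of_forall_eq {V ι : Type*} [AddCommGroup V] [Module ℝ V] {v w : ι → V}
    (hv : LinearIndependent ℝ v) (h : ∀ i, w i = v i) : LinearIndependent ℝ w := by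
  rwa [funext h]

/-! ### Poisson tensors with the last coordinate as a Casimir function -/

/-- The gradient of a covector in the standard coordinates. -/
noncomputable def coordsOfCovector (N : ℕ) : ((Fin N → ℝ) →L[ℝ] ℝ) →ₗ[ℝ] (Fin N → ℝ) where
  toFun L := fun i => L (Pi.single i 1)
  map_add' _ _ := rfl
  map_smul' _ _ := rfl

theorem coordsOfCovector_injective (N : ℕ) : Function.Injective (coordsOfCovector N) := by
  intro L L' h
  apply ContinuousLinearMap.coe_injective
  refine LinearMap.pi_ext' fun i => LinearMap.ext_ring ?_
  exact congrFun h i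

/-- Matrix form of the bracket, in which bilinearity is visible and `mem_span_of_complete` applies.
-/
theorem PoissonTensor.bracket_eq_dotProduct {N : ℕ} (P : PoissonTensor N)
    (f g : (Fin N → ℝ) → ℝ) (x : Fin N → ℝ) :
    P.bracket f g x = coordsOfCovector N (fderiv ℝ f x) ⬝ᵥ
      (P x).mulVec (coordsOfCovector N (fderiv ℝ g x)) := by
  simp only [PoissonTensor.bracket, dotProduct, Matrix.mulVec, coordsOfCovector,
    LinearMap.coe_mk, AddHom.coe_mk, Finset.mul_sum]
  refine Finset.sum_congr rfl fun i _ => Finset.sum_congr rfl fun j _ => by ring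

/-- The inclusion of `ℝ^n` in `ℝ^{n+1}` with last coordinate zero. -/
noncomputable def snocZero (n : ℕ) : (Fin n → ℝ) →L[ℝ] (Fin (n + 1) → ℝ) :=
  ContinuousLinearMap.pi
    (Fin.lastCases (motive := fun _ => (Fin n → ℝ) →L[ℝ] ℝ) 0
      (fun i => ContinuousLinearMap.proj i))

theorem snocZero_apply {n : ℕ} (v : Fin n → ℝ) :
    snocZero n v = Fin.snoc (α := fun _ => ℝ) v 0 := by
  funext i
  refine Fin.lastCases ?_ (fun j => ?_) i <;> simp [snocZero]

theorem snocZero_single {n : ℕ} (i : Fin n) :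
    snocZero n (Pi.single i 1) = Pi.single i.castSucc 1 := by
  rw [snocZero_apply]
  funext j
  refine Fin.lastCases ?_ (fun j => ?_) j
  · simp
  · simp [Pi.single_apply]

theorem snoc_eq_snocZero_add {n : ℕ} (v : Fin n → ℝ) (c : ℝ) :
    (Fin.snoc (α := fun _ => ℝ) v c : Fin (n + 1) → ℝ)
      = snocZero n v + Pi.single (Fin.last n) c := by
  rw [snocZero_apply]
  funext j
  refine Fin.lastCases ?_ (fun j => ?_) j <;> simp

theorem contDiff_snoc (n : ℕ) (c : ℝ) :
    ContDiff ℝ ∞ (fun v : Fin n → ℝ => (Fin.snoc (α := fun _ => ℝ) v c : Fin (n + 1) → ℝ)) := by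
  simp only [snoc_eq_snocZero_add]
  exact (snocZero n).contDiff.add contDiff_const

theorem fderiv_comp_snoc {n : ℕ} {f : (Fin (n + 1) → ℝ) → ℝ} (hf : Differentiable ℝ f)
    (v : Fin n → ℝ) (c : ℝ) :
    fderiv ℝ (fun y : Fin n → ℝ => f (Fin.snoc (α := fun _ => ℝ) y c)) v
      = (fderiv ℝ f (Fin.snoc (α := fun _ => ℝ) v c)).comp (snocZero n) := by
  have h : HasFDerivAt (fun y : Fin n → ℝ => (Fin.snoc (α := fun _ => ℝ) y c : Fin (n + 1) → ℝ))
      (snocZero n) v := by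
    simp only [snoc_eq_snocZero_add]
    exact (snocZero n).hasFDerivAt.add_const _
  exact ((hf _).hasFDerivAt.comp v h).fderiv

theorem snoc_init_self {n : ℕ} (x : Fin (n + 1) → ℝ) :
    (Fin.snoc (α := fun _ => ℝ) (fun j => x j.castSucc) (x (Fin.last n)) : Fin (n + 1) → ℝ) = x :=
  Fin.snoc_init_self x

/-- `P` restricts to `Q c` on the hyperplanes `x_{n+1} = c`, and `x_{n+1}` is a Casimir function. -/
structure PoissonTensor.IsFamily {n : ℕ} (P : PoissonTensor (n + 1)) (Q : ℝ → PoissonTensor n) :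
    Prop where
  castSucc : ∀ x (i j : Fin n),
    P x i.castSucc j.castSucc = Q (x (Fin.last n)) (fun j => x j.castSucc) i j
  last_right : ∀ x i, P x i (Fin.last n) = 0
  last_left : ∀ x j, P x (Fin.last n) j = 0

namespace PoissonTensor.IsFamily

variable {n : ℕ} {P : PoissonTensor (n + 1)} {Q : ℝ → PoissonTensor n}

/-- All terms with the index `n + 1` vanish, so no derivative transverse to the hyperplane enters:
restriction respects brackets. -/
theorem bracket_snoc (hP : P.IsFamily Q) {f g : (Fin (n + 1) → ℝ) → ℝ}
    (hf : Differentiable ℝ f) (hg : Differentiable ℝ g) (v : Fin n → ℝ) (c : ℝ) :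
    (Q c).bracket (fun y => f (Fin.snoc (α := fun _ => ℝ) y c))
        (fun y => g (Fin.snoc (α := fun _ => ℝ) y c)) v
      = P.bracket f g (Fin.snoc (α := fun _ => ℝ) v c) := by
  simp only [PoissonTensor.bracket, Fin.sum_univ_castSucc, hP.castSucc, hP.last_left,
    hP.last_right, fderiv_comp_snoc hf, fderiv_comp_snoc hg, ContinuousLinearMap.comp_apply,
    snocZero_single, Fin.snoc_castSucc, Fin.snoc_last, mul_zero, add_zero,
    Finset.sum_const_zero]

theorem eulerField_castSucc (hP : P.IsFamily Q) {H : (Fin (n + 1) → ℝ) → ℝ}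
    (hH : Differentiable ℝ H) (x : Fin (n + 1) → ℝ) (i : Fin n) :
    P.eulerField H x i.castSucc = (Q (x (Fin.last n))).eulerField
      (fun y => H (Fin.snoc (α := fun _ => ℝ) y (x (Fin.last n)))) (fun j => x j.castSucc) i := by
  have := hP.bracket_snoc (f := fun y => y i.castSucc) (differentiable_apply _) hH
    (fun j => x j.castSucc) (x (Fin.last n))
  rw [snoc_init_self] at this
  simp only [PoissonTensor.eulerField]
  rw [← this]
  simp only [Fin.snoc_castSucc]

theorem eulerField_last (hP : P.IsFamily Q) {H : (Fin (n + 1) → ℝ) → ℝ}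
    (hH : Differentiable ℝ H) (x : Fin (n + 1) → ℝ) :
    P.eulerField H x (Fin.last n) = 0 := by
  have := hP.bracket_snoc (f := fun y => y (Fin.last n)) (differentiable_apply _) hH
    (fun j => x j.castSucc) (x (Fin.last n))
  rw [snoc_init_self] at this
  simp only [PoissonTensor.eulerField]
  rw [← this]
  simp [PoissonTensor.bracket]

theorem rank_snoc (hP : P.IsFamily Q) (v : Fin n → ℝ) (c : ℝ) :
    (P (Fin.snoc (α := fun _ => ℝ) v c)).rank = (Q c v).rank := by
  set E : Matrix (Fin (n + 1)) (Fin n) ℝ :=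
    Matrix.of fun i j => if i = j.castSucc then 1 else 0 with hE
  -- `P` is `Q c` bordered by zeros. Expressing each as a product containing the other bounds the
  -- ranks both ways.
  have h1 : P (Fin.snoc (α := fun _ => ℝ) v c) = E * Q c v * E.transpose := by
    ext i j
    refine Fin.lastCases ?_ (fun i => ?_) i
    · simp [hP.last_left, hE, Matrix.mul_apply, (Fin.castSucc_ne_last _).symm]
    · refine Fin.lastCases ?_ (fun j => ?_) j
      · simp [hP.last_right, hE, Matrix.mul_apply, (Fin.castSucc_ne_last _).symm]
      · simp [hP.castSucc, hE, Matrix.mul_apply]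
  have h2 : Q c v = E.transpose * P (Fin.snoc (α := fun _ => ℝ) v c) * E := by
    have hEE : E.transpose * E = 1 := by
      ext i j
      simp [hE, Matrix.mul_apply, Matrix.one_apply, eq_comm]
    rw [h1]
    calc Q c v = (E.transpose * E) * Q c v * (E.transpose * E) := by simp [hEE]
      _ = _ := by simp only [Matrix.mul_assoc]
  apply le_antisymm
  · rw [h1]
    exact (Matrix.rank_mul_le_left _ _).trans (Matrix.rank_mul_le_right _ _)
  · conv_lhs => rw [h2]
    exact (Matrix.rank_mul_le_left _ _).trans (Matrix.rank_mul_le_right _ _)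

/-- The differential of the Casimir function `x_{n+1}` is spanned by those of the central
integrals. -/
theorem exists_sum_fderiv_eq_proj (hP : P.IsFamily Q) {s k : ℕ}
    {f : Fin s → (Fin (n + 1) → ℝ) → ℝ} {h : Fin k → (Fin (n + 1) → ℝ) → ℝ} {x : Fin (n + 1) → ℝ}
    (hff : ∀ i j, P.bracket (f i) (f j) x = 0) (hfh : ∀ i j, P.bracket (f i) (h j) x = 0)
    (hli : LinearIndependent ℝ (fun i : Fin s ⊕ Fin k => fderiv ℝ (Sum.elim f h i) x))
    (hr : 2 * s + k + (P x).rank = 2 * (n + 1)) :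
    ∃ a : Fin s → ℝ, ∑ i, a i • fderiv ℝ (f i) x
      = (ContinuousLinearMap.proj (Fin.last n) : (Fin (n + 1) → ℝ) →L[ℝ] ℝ) := by
  have hli' := hli.map' (coordsOfCovector (n + 1))
    (LinearMap.ker_eq_bot.2 (coordsOfCovector_injective _))
  have he : Matrix.vecMul (coordsOfCovector (n + 1)
      (ContinuousLinearMap.proj (Fin.last n) : (Fin (n + 1) → ℝ) →L[ℝ] ℝ)) (P x) = 0 := by
    funext j
    simp only [Matrix.vecMul, dotProduct, coordsOfCovector, LinearMap.coe_mk, AddHom.coe_mk,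
      ContinuousLinearMap.proj_apply, Pi.zero_apply]
    refine Finset.sum_eq_zero fun i _ => ?_
    refine Fin.lastCases ?_ (fun i => ?_) i
    · rw [hP.last_left, mul_zero]
    · simp
  have hmem := mem_span_of_complete (P x) (fun i => coordsOfCovector _ (fderiv ℝ (f i) x))
    (fun i => coordsOfCovector _ (fderiv ℝ (h i) x)) (by
      refine linearIndependent_of_forall_eq hli' fun i => ?_
      rcases i with i | i <;> rfl)
    (fun i j => by rw [← P.bracket_eq_dotProduct]; exact hff i j)
    (fun i j => by rw [← P.bracket_eq_dotProduct]; exact hfh i j) hr _ he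
  obtain ⟨a, ha⟩ := (Submodule.mem_span_range_iff_exists_fun ℝ).1 hmem
  refine ⟨a, coordsOfCovector_injective _ ?_⟩
  rw [← ha, map_sum]
  simp only [map_smul]

end PoissonTensor.IsFamily

/-! ### Descent of integrability to almost every hyperplane -/

theorem ae_ae_snoc {n : ℕ} {p : (Fin (n + 1) → ℝ) → Prop} (h : ∀ᵐ x, p x) :
    ∀ᵐ c : ℝ, ∀ᵐ v : Fin n → ℝ, p (Fin.snoc (α := fun _ => ℝ) v c) := by
  have hmp := (volume_preserving_piFinSuccAbove (fun _ : Fin (n + 1) => ℝ) (Fin.last n)).symm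
  have h1 := hmp.quasiMeasurePreserving.ae h
  have h2 := Measure.ae_ae_of_ae_prod h1
  filter_upwards [h2] with c hc
  filter_upwards [hc] with v hv
  convert hv using 1
  exact (Fin.insertNth_last' c v).symm

/-- Identifies the kernel of restriction of covectors to the hyperplane, as the hypothesis on `φ` in
`linearIndependent_shear` demands. -/
theorem comp_snocZero_eq_zero {n : ℕ} (L : (Fin (n + 1) → ℝ) →L[ℝ] ℝ)
    (h : L.comp (snocZero n) = 0) :
    L = L (Pi.single (Fin.last n) 1) •
      (ContinuousLinearMap.proj (Fin.last n) : (Fin (n + 1) → ℝ) →L[ℝ] ℝ) := by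
  apply coordsOfCovector_injective
  funext i
  refine Fin.lastCases ?_ (fun i => ?_) i
  · simp [coordsOfCovector]
  · have := congrArg (fun T : (Fin n → ℝ) →L[ℝ] ℝ => T (Pi.single i 1)) h
    simp only [ContinuousLinearMap.comp_apply, snocZero_single] at this
    simpa [coordsOfCovector] using this

/-- Integrability descends to almost all hyperplanes `x_{n+1} = c`. -/
theorem PoissonTensor.IsFamily.ae_isIntegrable {n : ℕ} {P : PoissonTensor (n + 1)}
    {Q : ℝ → PoissonTensor n} (hP : P.IsFamily Q) {H' : (Fin (n + 1) → ℝ) → ℝ}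
    {H : (Fin n → ℝ) → ℝ} (hH' : Differentiable ℝ H') {r : ℝ → ℝ}
    (hH : ∀ v c, H' (Fin.snoc (α := fun _ => ℝ) v c) = H v + r c) {k : ℕ}
    (hint : P.IsIntegrable H' k) : ∀ᵐ c : ℝ, (Q c).IsIntegrable H k := by
  obtain ⟨s, f, h, hfs, hhs, hfH, hhH, hff, hfh, hae⟩ := hint
  have hspan : ∀ᵐ x : Fin (n + 1) → ℝ, ∃ a : Fin s → ℝ, ∑ i, a i • fderiv ℝ (f i) x
      = (ContinuousLinearMap.proj (Fin.last n) : (Fin (n + 1) → ℝ) →L[ℝ] ℝ) := by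
    filter_upwards [hae] with x hx
    exact hP.exists_sum_fderiv_eq_proj (fun i j => hff i j x) (fun i j => hfh i j x) hx.1 hx.2
  have hproj : (ContinuousLinearMap.proj (Fin.last n) : (Fin (n + 1) → ℝ) →L[ℝ] ℝ) ≠ 0 := by
    intro h0
    have := congrArg (fun T : (Fin (n + 1) → ℝ) →L[ℝ] ℝ => T (Pi.single (Fin.last n) 1)) h0
    simp at this
  -- Without commuting integrals the Casimir differential would be an empty sum, so `s ≥ 1` and one
  -- of them can be given up.
  rcases s with _ | s
  · obtain ⟨x, a, ha⟩ := hspan.exists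
    simp only [Finset.univ_eq_empty, Finset.sum_empty] at ha
    exact absurd ha.symm hproj
  have hfd : ∀ i, Differentiable ℝ (f i) := fun i => (hfs i).differentiable (by simp)
  have hhd : ∀ i, Differentiable ℝ (h i) := fun i => (hhs i).differentiable (by simp)
  -- `D ν x` lists the differentials at `x`, restricted to the hyperplane directions, of the sheared
  -- integrals and of the `h_j`.
  let D : (Fin s → ℝ) → (Fin (n + 1) → ℝ) → Fin s ⊕ Fin k → ((Fin n → ℝ) →L[ℝ] ℝ) :=
    fun ν x => Sum.elim
      (fun j => (fderiv ℝ (f j.castSucc) x - ν j • fderiv ℝ (f (Fin.last s)) x).comp (snocZero n))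
      (fun j => (fderiv ℝ (h j) x).comp (snocZero n))
  have hD : Continuous (fun q : (Fin s → ℝ) × (Fin (n + 1) → ℝ) => D q.1 q.2) := by
    refine continuous_pi fun i => ?_
    have hc : ∀ {F : (Fin (n + 1) → ℝ) → ℝ}, ContDiff ℝ ∞ F →
        Continuous fun q : (Fin s → ℝ) × (Fin (n + 1) → ℝ) => fderiv ℝ F q.2 := fun hF =>
      (hF.continuous_fderiv (by simp)).comp continuous_snd
    rcases i with j | j
    · exact ((hc (hfs _)).sub (((continuous_apply j).comp continuous_fst).smul
        (hc (hfs _)))).clm_comp continuous_const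
    · exact (hc (hhs _)).clm_comp continuous_const
  -- Linear independence is an open condition and `D` is continuous; this supplies the measurability
  -- needed to interchange the two quantifiers.
  have hmeas : MeasurableSet {q : (Fin s → ℝ) × (Fin (n + 1) → ℝ) |
      LinearIndependent ℝ (D q.1 q.2)} :=
    (isOpen_setOfPred_linearIndependent.preimage hD).measurableSet
  have hgood : ∀ᵐ x : Fin (n + 1) → ℝ, ∀ᵐ ν : Fin s → ℝ, LinearIndependent ℝ (D ν x) := by
    filter_upwards [hae, hspan] with x hx hax
    obtain ⟨a, ha⟩ := hax
    have ha0 : a ≠ 0 := by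
      rintro rfl
      simp only [Pi.zero_apply, zero_smul, Finset.sum_const_zero] at ha
      exact hproj ha.symm
    filter_upwards [ae_affine_ne_zero a ha0] with ν hν
    refine linearIndependent_shear (fun i => fderiv ℝ (f i) x) (fun i => fderiv ℝ (h i) x) ?_ a
      { toFun := fun L : (Fin (n + 1) → ℝ) →L[ℝ] ℝ => L.comp (snocZero n)
        map_add' := fun _ _ => rfl
        map_smul' := fun _ _ => rfl } ?_ ν hν
    · refine linearIndependent_of_forall_eq hx.1 fun i => ?_
      rcases i with i | i <;> rfl
    · intro L hL
      exact ⟨_, by rw [ha]; exact comp_snocZero_eq_zero L hL⟩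
  -- One constant `ν` is fixed that is good for almost every `x`; constancy keeps the sheared
  -- functions smooth first integrals.
  obtain ⟨ν, hν⟩ := ((Measure.ae_ae_comm (μ := volume) (ν := volume)
    (p := fun (ν : Fin s → ℝ) x => LinearIndependent ℝ (D ν x)) hmeas).2 hgood).exists
  filter_upwards [ae_ae_snoc (hν.and hae)] with c hc
  have hsn := contDiff_snoc n c
  have hHc : ∀ v, fderiv ℝ (fun y => H' (Fin.snoc (α := fun _ => ℝ) y c)) v = fderiv ℝ H v := by
    intro v
    simp only [hH]
    rw [fderiv_add_const]
  have hbH : ∀ (F : (Fin n → ℝ) → ℝ) v, (Q c).bracket F H v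
      = (Q c).bracket F (fun y => H' (Fin.snoc (α := fun _ => ℝ) y c)) v := by
    intro F v
    simp only [PoissonTensor.bracket, hHc]
  have hFd : ∀ j : Fin s, Differentiable ℝ
      (fun x => f j.castSucc x - ν j * f (Fin.last s) x) := fun j =>
    (hfd _).sub ((hfd _).const_mul _)
  have hFderiv : ∀ (j : Fin s) x, fderiv ℝ (fun x => f j.castSucc x - ν j * f (Fin.last s) x) x
      = fderiv ℝ (f j.castSucc) x - ν j • fderiv ℝ (f (Fin.last s)) x := fun j x =>
    ((hfd _ x).hasFDerivAt.sub ((hfd _ x).hasFDerivAt.const_mul _)).fderiv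
  have hlin : ∀ (j : Fin s) (g : (Fin (n + 1) → ℝ) → ℝ) x,
      P.bracket (fun x => f j.castSucc x - ν j * f (Fin.last s) x) g x
        = P.bracket (f j.castSucc) g x - ν j * P.bracket (f (Fin.last s)) g x := by
    intro j g x
    simp only [PoissonTensor.bracket_eq_dotProduct, hFderiv, map_sub, map_smul, sub_dotProduct,
      smul_dotProduct, smul_eq_mul]
  have hlin' : ∀ (j : Fin s) (g : (Fin (n + 1) → ℝ) → ℝ) x,
      P.bracket g (fun x => f j.castSucc x - ν j * f (Fin.last s) x) x
        = P.bracket g (f j.castSucc) x - ν j * P.bracket g (f (Fin.last s)) x := by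
    intro j g x
    simp only [PoissonTensor.bracket_eq_dotProduct, hFderiv, map_sub, map_smul, Matrix.mulVec_sub,
      Matrix.mulVec_smul, dotProduct_sub, dotProduct_smul, smul_eq_mul]
  refine ⟨s, fun j v => f j.castSucc (Fin.snoc (α := fun _ => ℝ) v c)
      - ν j * f (Fin.last s) (Fin.snoc (α := fun _ => ℝ) v c),
    fun j v => h j (Fin.snoc (α := fun _ => ℝ) v c), ?_, ?_, ?_, ?_, ?_, ?_, ?_⟩
  · exact fun i => ((hfs _).comp hsn).sub (contDiff_const.mul ((hfs _).comp hsn))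
  · exact fun i => (hhs _).comp hsn
  · intro i x
    rw [hbH, hP.bracket_snoc (hFd i) hH', hlin, hfH, hfH]; simp
  · intro i x
    rw [hbH, hP.bracket_snoc (hhd i) hH', hhH]
  · intro i j x
    rw [hP.bracket_snoc (hFd i) (hFd j), hlin, hlin', hlin', hff, hff, hff, hff]; simp
  · intro i j x
    rw [hP.bracket_snoc (hFd i) (hhd j), hlin, hfh, hfh]; simp
  · filter_upwards [hc] with v hv
    refine ⟨?_, ?_⟩
    · convert hv.1 using 1
      funext i
      rcases i with j | j
      · simp only [Sum.elim_inl, D]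
        rw [← hFderiv]
        exact fderiv_comp_snoc (hFd j) v c
      · simp only [Sum.elim_inr, D]
        exact fderiv_comp_snoc (hhd j) v c
    · have := hv.2.2
      rw [hP.rank_snoc] at this
      -- Here `2(s+1) + k + rank = 2(n+1)` becomes `2s + k + rank = 2n`.
      omega

/-! ### The Lie–Poisson tensor of a central extension -/

section CentralExtension

variable {L : Type*} [LieRing L] [LieAlgebra ℝ L] {n : ℕ}

theorem centralBasis_repr (b : Module.Basis (Fin n) ℝ L) (α : twoCocycle ℝ L ℝ)
    (y : LieAlgebra.ofTwoCocycle α) (k : Fin (n + 1)) :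
    (centralBasis b α).repr y k
      = Fin.snoc (α := fun _ => ℝ) (fun i => b.repr y.carrier.1 i) y.carrier.2 k := rfl

theorem centralBasis_castSucc (b : Module.Basis (Fin n) ℝ L) (α : twoCocycle ℝ L ℝ) (i : Fin n) :
    centralBasis b α i.castSucc = LieAlgebra.ofProd α (b i, 0) := by
  apply (centralBasis b α).repr.injective
  ext k
  rw [Module.Basis.repr_self, centralBasis_repr]
  refine Fin.lastCases ?_ (fun j => ?_) k
  · simp [LieAlgebra.ofProd]
  · simp [LieAlgebra.ofProd, Finsupp.single_apply]

theorem centralBasis_last (b : Module.Basis (Fin n) ℝ L) (α : twoCocycle ℝ L ℝ) :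
    centralBasis b α (Fin.last n) = LieAlgebra.ofProd α (0, 1) := by
  apply (centralBasis b α).repr.injective
  ext k
  rw [Module.Basis.repr_self, centralBasis_repr]
  refine Fin.lastCases ?_ (fun j => ?_) k <;> simp [LieAlgebra.ofProd]

theorem bracket_ofProd (α : twoCocycle ℝ L ℝ) (u v : L) (s t : ℝ) :
    ⁅LieAlgebra.ofProd α (u, s), LieAlgebra.ofProd α (v, t)⁆
      = LieAlgebra.ofProd α (⁅u, v⁆, α.1 u v) := by
  rw [LieAlgebra.bracket_ofTwoCocycle]
  have h1 : ⁅u, t⁆ = (0 : ℝ) := rfl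
  have h2 : ⁅v, s⁆ = (0 : ℝ) := rfl
  simp only [Equiv.symm_apply_apply, h1, h2, add_zero, sub_zero]
  rfl

/-- The Lie–Poisson tensor of a central extension consists of the magnetic Lie–Poisson tensors. -/
theorem isFamily_liePoisson_centralBasis (b : Module.Basis (Fin n) ℝ L) (α : twoCocycle ℝ L ℝ) :
    (liePoisson (centralBasis b α)).IsFamily
      (fun c x => liePoisson b x + Matrix.of fun i j => c * α.1 (b i) (b j)) where
  castSucc x i j := by
    simp only [liePoisson, Matrix.of_apply, Matrix.add_apply, centralBasis_castSucc,
      bracket_ofProd, centralBasis_repr, Fin.sum_univ_castSucc, Fin.snoc_castSucc, Fin.snoc_last]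
    simp [LieAlgebra.ofProd, mul_comm]
  last_right x i := by
    have h : ⁅centralBasis b α i, centralBasis b α (Fin.last n)⁆ = 0 := by
      rw [centralBasis_last]
      obtain ⟨⟨u, s⟩, hu⟩ := (LieAlgebra.ofProd α).surjective (centralBasis b α i)
      rw [← hu, bracket_ofProd]
      simp only [lie_zero, map_zero]
      rfl
    simp [liePoisson, h]
  last_left x j := by
    have h : ⁅centralBasis b α (Fin.last n), centralBasis b α j⁆ = 0 := by
      rw [centralBasis_last]
      obtain ⟨⟨u, s⟩, hu⟩ := (LieAlgebra.ofProd α).surjective (centralBasis b α j)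
      rw [← hu, bracket_ofProd]
      simp only [zero_lie, map_zero, LinearMap.zero_apply]
      rfl
    simp [liePoisson, h]

/-- Structure constants are invariant under isomorphism. This is needed because the Lie algebra of
`G_B` is only isomorphic to the extension. -/
theorem liePoisson_map {L' : Type*} [LieRing L'] [LieAlgebra ℝ L'] {N : ℕ}
    (b : Module.Basis (Fin N) ℝ L) (φ : L ≃ₗ⁅ℝ⁆ L') :
    liePoisson (b.map φ.toLinearEquiv) = liePoisson b := by
  funext x
  ext i j
  simp only [liePoisson, Matrix.of_apply, Module.Basis.map_apply, Module.Basis.map_repr,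
    LinearEquiv.trans_apply]
  refine Finset.sum_congr rfl fun k _ => ?_
  congr 3
  change φ.toLinearEquiv.symm ⁅φ (b i), φ (b j)⁆ = _
  rw [← LieEquiv.map_lie]
  exact φ.toLinearEquiv.symm_apply_apply _

end CentralExtension

/-! ### The Hamiltonians -/

theorem contDiff_horHamiltonian (n : ℕ) : ContDiff ℝ ∞ (horHamiltonian n) := by
  unfold horHamiltonian sqHamiltonian
  fun_prop

theorem contDiff_extHamiltonian (n : ℕ) : ContDiff ℝ ∞ (extHamiltonian n) := by
  unfold extHamiltonian sqHamiltonian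
  fun_prop

theorem extHamiltonian_snoc {n : ℕ} (v : Fin n → ℝ) (c : ℝ) :
    extHamiltonian n (Fin.snoc (α := fun _ => ℝ) v c) = sqHamiltonian n v + c ^ 2 / 2 := by
  simp [extHamiltonian]

theorem horHamiltonian_snoc {n : ℕ} (v : Fin n → ℝ) (c : ℝ) :
    horHamiltonian n (Fin.snoc (α := fun _ => ℝ) v c) = sqHamiltonian n v := by
  simp [horHamiltonian]

theorem extHamiltonian_eq (n : ℕ) : extHamiltonian n = sqHamiltonian (n + 1) := by
  funext x
  simp only [extHamiltonian, sqHamiltonian, Fin.sum_univ_castSucc]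
  ring

theorem fderiv_sqHamiltonian {n : ℕ} (x : Fin n → ℝ) (j : Fin n) :
    fderiv ℝ (sqHamiltonian n) x (Pi.single j 1) = x j := by
  have h : HasFDerivAt (sqHamiltonian n) ((1 / 2 : ℝ) • ∑ i, (2 * x i ^ (2 - 1)) •
      (ContinuousLinearMap.proj i : (Fin n → ℝ) →L[ℝ] ℝ)) x := by
    refine HasFDerivAt.const_mul (HasFDerivAt.fun_sum fun i _ => ?_) _
    simpa using (hasFDerivAt_apply (𝕜 := ℝ) i x).pow 2
  rw [h.fderiv]
  simp [Pi.single_apply]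

theorem eulerField_sqHamiltonian {n : ℕ} (P : PoissonTensor n) (x : Fin n → ℝ) (i : Fin n) :
    P.eulerField (sqHamiltonian n) x i = ∑ j, P x i j * x j := by
  have h : ∀ k, fderiv ℝ (fun y : Fin n → ℝ => y i) x (Pi.single k 1) = if i = k then 1 else 0 := by
    intro k
    rw [(hasFDerivAt_apply (𝕜 := ℝ) i x).fderiv]
    simp [Pi.single_apply]
  simp only [PoissonTensor.eulerField, PoissonTensor.bracket, h, fderiv_sqHamiltonian]
  rw [Finset.sum_eq_single i]
  · simp [mul_comm]
  · intro k _ hk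
    simp [hk.symm]
  · simp

namespace PoissonTensor.IsFamily

variable {n : ℕ} {P : PoissonTensor (n + 1)} {Q : ℝ → PoissonTensor n}

theorem eulerField_extHamiltonian_castSucc (hP : P.IsFamily Q) (x : Fin (n + 1) → ℝ) (i : Fin n) :
    P.eulerField (extHamiltonian n) x i.castSucc
      = (Q (x (Fin.last n))).eulerField (sqHamiltonian n) (fun j => x j.castSucc) i := by
  rw [hP.eulerField_castSucc ((contDiff_extHamiltonian n).differentiable (by simp))]
  simp only [extHamiltonian_snoc, PoissonTensor.eulerField, PoissonTensor.bracket,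
    fderiv_add_const]

theorem eulerField_extHamiltonian_last (hP : P.IsFamily Q) (x : Fin (n + 1) → ℝ) :
    P.eulerField (extHamiltonian n) x (Fin.last n) = 0 :=
  hP.eulerField_last ((contDiff_extHamiltonian n).differentiable (by simp)) x

/-- On each hyperplane the two Hamiltonians differ by the constant `c² / 2`. -/
theorem eulerField_extHamiltonian_eq_horHamiltonian (hP : P.IsFamily Q) :
    P.eulerField (extHamiltonian n) = P.eulerField (horHamiltonian n) := by
  have hd := (contDiff_horHamiltonian n).differentiable (by simp)
  funext x i
  refine Fin.lastCases ?_ (fun i => ?_) i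
  · rw [hP.eulerField_extHamiltonian_last, hP.eulerField_last hd]
  · rw [hP.eulerField_extHamiltonian_castSucc, hP.eulerField_castSucc hd]
    simp only [horHamiltonian_snoc]

/-- A curve solves the Euler equations of `P` if and only if its last coordinate is a constant `c`
and the other coordinates solve the Euler equations of `Q c`. -/
theorem isSolutionOn_iff (hP : P.IsFamily Q) (J : Set ℝ) (γ : ℝ → Fin (n + 1) → ℝ)
    (hJ : J.OrdConnected) :
    P.IsSolutionOn (extHamiltonian n) γ J ↔ ∃ c : ℝ, (∀ t ∈ J, γ t (Fin.last n) = c) ∧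
      (Q c).IsSolutionOn (sqHamiltonian n) (fun t i => γ t i.castSucc) J := by
  constructor
  · intro h
    have hlast : ∀ t ∈ J, HasDerivWithinAt (fun t => γ t (Fin.last n)) 0 J t := fun t ht => by
      have := hasDerivWithinAt_pi.1 (h t ht) (Fin.last n)
      rwa [hP.eulerField_extHamiltonian_last] at this
    obtain ⟨c, hc⟩ : ∃ c, ∀ t ∈ J, γ t (Fin.last n) = c := by
      rcases J.eq_empty_or_nonempty with rfl | ⟨t₀, ht₀⟩
      · exact ⟨0, by simp⟩
      · refine ⟨γ t₀ (Fin.last n), fun t ht => ?_⟩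
        -- The mean value inequality with bound `0` on the convex set `J`.
        have := hJ.convex.norm_image_sub_le_of_norm_hasDerivWithin_le (C := 0) hlast
          (fun _ _ => by simp) ht₀ ht
        rw [zero_mul] at this
        exact sub_eq_zero.1 (norm_le_zero_iff.1 this)
    refine ⟨c, hc, fun t ht => hasDerivWithinAt_pi.2 fun i => ?_⟩
    have := hasDerivWithinAt_pi.1 (h t ht) i.castSucc
    rwa [hP.eulerField_extHamiltonian_castSucc, hc t ht] at this
  · rintro ⟨c, hc, h⟩ t ht
    refine hasDerivWithinAt_pi.2 fun i => ?_
    refine Fin.lastCases ?_ (fun i => ?_) i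
    · rw [hP.eulerField_extHamiltonian_last]
      exact (hasDerivWithinAt_const t J c).congr hc (hc t ht)
    · rw [hP.eulerField_extHamiltonian_castSucc, hc t ht]
      exact hasDerivWithinAt_pi.1 (h t ht) i

end PoissonTensor.IsFamily

/-! ### Momentum functions of vector fields in canonical coordinates -/

section MomentumFunctions

open scoped RealInnerProductSpace

variable {n N : ℕ} {V : Fin N → EuclideanSpace ℝ (Fin n) → EuclideanSpace ℝ (Fin n)}
  {y p : EuclideanSpace ℝ (Fin n)}

theorem fderiv_comp_momentum (hV : ∀ a, DifferentiableAt ℝ (V a) y) {f : (Fin N → ℝ) → ℝ}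
    (hf : Differentiable ℝ f) (u v : EuclideanSpace ℝ (Fin n)) :
    fderiv ℝ (fun w : EuclideanSpace ℝ (Fin n) × EuclideanSpace ℝ (Fin n) =>
        f (fun a => -⟪w.2, V a w.1⟫)) (y, p) (u, v)
      = -∑ a, fderiv ℝ f (fun a => -⟪p, V a y⟫) (Pi.single a 1)
          * (⟪p, fderiv ℝ (V a) y u⟫ + ⟪v, V a y⟫) := by
  have h1 : ∀ a, HasFDerivAt (fun w : EuclideanSpace ℝ (Fin n) × EuclideanSpace ℝ (Fin n) =>
      V a w.1) ((fderiv ℝ (V a) y).comp (ContinuousLinearMap.fst ℝ _ _)) (y, p) := fun a =>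
    HasFDerivAt.comp (𝕜 := ℝ) (g := V a) (f := Prod.fst) (y, p) (hV a).hasFDerivAt hasFDerivAt_fst
  have h2 := fun a => ((hasFDerivAt_snd (𝕜 := ℝ) (p := (y, p))).inner ℝ (h1 a)).neg
  have h3 := (hf _).hasFDerivAt.comp (y, p) (hasFDerivAt_pi.2 h2)
  have h4 : fderiv ℝ (fun w : EuclideanSpace ℝ (Fin n) × EuclideanSpace ℝ (Fin n) =>
        f (fun a => -⟪w.2, V a w.1⟫)) (y, p)
      = (fderiv ℝ f (fun a => -⟪p, V a y⟫)).comp _ := h3.fderiv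
  rw [h4, ContinuousLinearMap.comp_apply]
  conv_lhs => rw [← ContinuousLinearMap.coe_coe, LinearMap.pi_apply_eq_sum_univ]
  rw [← Finset.sum_neg_distrib]
  refine Finset.sum_congr rfl fun a _ => ?_
  have hs : (fun j => if a = j then (1 : ℝ) else 0) = Pi.single a 1 := by
    funext j; simp [Pi.single_apply, eq_comm]
  rw [hs]
  simp only [ContinuousLinearMap.coe_pi', neg_apply,
    ContinuousLinearMap.comp_apply, ContinuousLinearMap.prod_apply, fderivInnerCLM_apply,
    ContinuousLinearMap.coe_fst', ContinuousLinearMap.coe_snd', smul_eq_mul,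
    ContinuousLinearMap.coe_coe]
  ring

/-- Contraction over the standard basis; it collapses the coordinate sums of the canonical bracket.
-/
theorem sum_inner_single_mul
    (A : EuclideanSpace ℝ (Fin n) →ₗ[ℝ] ℝ) (v : EuclideanSpace ℝ (Fin n)) :
    ∑ i, A (EuclideanSpace.single i 1) * ⟪EuclideanSpace.single i (1 : ℝ), v⟫ = A v := by
  have hv : v = ∑ i, ⟪EuclideanSpace.single i (1 : ℝ), v⟫ • EuclideanSpace.single i (1 : ℝ) := by
    ext j
    simp [Finset.sum_apply, Pi.single_apply, EuclideanSpace.inner_single_left]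
  conv_rhs => rw [hv, map_sum]
  exact Finset.sum_congr rfl fun i _ => by rw [map_smul, smul_eq_mul, mul_comm]

/-- The canonical bracket of functions of the momenta `-⟨p, V_a⟩` in the magnetic field `β`. -/
theorem canonical_bracket_comp_momentum (hV : ∀ a, DifferentiableAt ℝ (V a) y)
    {f g : (Fin N → ℝ) → ℝ} (hf : Differentiable ℝ f) (hg : Differentiable ℝ g)
    (β : EuclideanSpace ℝ (Fin n) →ₗ[ℝ] EuclideanSpace ℝ (Fin n) →ₗ[ℝ] ℝ)
    {D : ((Fin N → ℝ) → ℝ) → EuclideanSpace ℝ (Fin n) × EuclideanSpace ℝ (Fin n) → ℝ}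
    (hD : ∀ F, D F = fderiv ℝ (fun w : EuclideanSpace ℝ (Fin n) × EuclideanSpace ℝ (Fin n) =>
        F (fun a => -⟪w.2, V a w.1⟫)) (y, p)) :
    ∑ i, (D f (EuclideanSpace.single i 1, 0) * D g (0, EuclideanSpace.single i 1)
          - D f (0, EuclideanSpace.single i 1) * D g (EuclideanSpace.single i 1, 0))
        + ∑ i, ∑ k, β (EuclideanSpace.single i 1) (EuclideanSpace.single k 1)
          * D f (0, EuclideanSpace.single i 1) * D g (0, EuclideanSpace.single k 1)
      = ∑ a, ∑ b, fderiv ℝ f (fun a => -⟪p, V a y⟫) (Pi.single a 1)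
          * fderiv ℝ g (fun a => -⟪p, V a y⟫) (Pi.single b 1)
          * (-⟪p, VectorField.lieBracket ℝ (V a) (V b) y⟫ + β (V a y) (V b y)) := by
  set φ : Fin N → ℝ := fun a => fderiv ℝ f (fun a => -⟪p, V a y⟫) (Pi.single a 1) with hφ
  set ψ : Fin N → ℝ := fun a => fderiv ℝ g (fun a => -⟪p, V a y⟫) (Pi.single a 1) with hψ
  -- For `F` with gradient `c` the `p`-derivative is `-Y c` and the `q`-derivative is `-A c`. The
  -- canonical part becomes `A φ (Y ψ) - A ψ (Y φ)`, whose coefficient at `φ_a ψ_b` is `⟨p, DV_a V_b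
  -- - DV_b V_a⟩ = -⟨p, [V_a, V_b]⟩`; the magnetic part becomes `β (Y φ) (Y ψ)`.
  let Y : (Fin N → ℝ) → EuclideanSpace ℝ (Fin n) := fun c => ∑ a, c a • V a y
  let A : (Fin N → ℝ) → (EuclideanSpace ℝ (Fin n) →ₗ[ℝ] ℝ) := fun c =>
    ∑ a, c a • ((innerSL ℝ p).comp (fderiv ℝ (V a) y)).toLinearMap
  have hq : ∀ (F : (Fin N → ℝ) → ℝ), Differentiable ℝ F → ∀ i,
      D F (EuclideanSpace.single i 1, 0)
        = -A (fun a => fderiv ℝ F (fun a => -⟪p, V a y⟫) (Pi.single a 1))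
          (EuclideanSpace.single i 1) := by
    intro F hF i
    rw [hD, fderiv_comp_momentum hV hF]
    simp [A, LinearMap.sum_apply]
  have hp : ∀ (F : (Fin N → ℝ) → ℝ), Differentiable ℝ F → ∀ i,
      D F (0, EuclideanSpace.single i 1)
        = -⟪EuclideanSpace.single i (1 : ℝ),
          Y (fun a => fderiv ℝ F (fun a => -⟪p, V a y⟫) (Pi.single a 1))⟫ := by
    intro F hF i
    rw [hD, fderiv_comp_momentum hV hF]
    simp only [Y, inner_sum, inner_smul_right]
    simp
  have e1 : ∑ i, (D f (EuclideanSpace.single i 1, 0) * D g (0, EuclideanSpace.single i 1)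
          - D f (0, EuclideanSpace.single i 1) * D g (EuclideanSpace.single i 1, 0))
      = A φ (Y ψ) - A ψ (Y φ) := by
    rw [← sum_inner_single_mul (A φ), ← sum_inner_single_mul (A ψ),
      ← Finset.sum_sub_distrib]
    refine Finset.sum_congr rfl fun i _ => ?_
    rw [hq f hf, hp g hg, hp f hf, hq g hg]
    ring
  have e2 : ∑ i, ∑ k, β (EuclideanSpace.single i 1) (EuclideanSpace.single k 1)
          * D f (0, EuclideanSpace.single i 1) * D g (0, EuclideanSpace.single k 1)
      = β (Y φ) (Y ψ) := by
    have h1 := sum_inner_single_mul (β.flip (Y ψ)) (Y φ)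
    rw [LinearMap.flip_apply] at h1
    rw [← h1]
    refine Finset.sum_congr rfl fun i _ => ?_
    rw [LinearMap.flip_apply, ← sum_inner_single_mul (β (EuclideanSpace.single i 1)),
      Finset.sum_mul]
    refine Finset.sum_congr rfl fun k _ => ?_
    rw [hp f hf, hp g hg]
    ring
  rw [e1, e2]
  simp only [A, Y, map_sum, map_smul, LinearMap.sum_apply, LinearMap.smul_apply, smul_eq_mul,
    ContinuousLinearMap.coe_coe, ContinuousLinearMap.comp_apply, innerSL_apply_apply,
    VectorField.lieBracket_eq, inner_sub_right, Finset.mul_sum]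
  have hsw : ∀ F : Fin N → Fin N → ℝ, ∑ a, ∑ b, F a b = ∑ b, ∑ a, F a b := fun F =>
    Finset.sum_comm
  rw [hsw (fun x i => ψ x * (φ i * ⟪p, fderiv ℝ (V i) y (V x y)⟫)),
    hsw (fun x i => ψ x * (φ i * β (V i y) (V x y)))]
  simp only [← Finset.sum_sub_distrib, ← Finset.sum_add_distrib]
  refine Finset.sum_congr rfl fun a _ => Finset.sum_congr rfl fun b _ => ?_
  simp only [hφ, hψ]
  ring

end MomentumFunctions

/-- The bilinear form of an alternating form of degree two. -/
noncomputable def bilinOfAlternating {M : Type*} [AddCommGroup M] [Module ℝ M] [TopologicalSpace M]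
    (β : M [⋀^Fin 2]→L[ℝ] ℝ) : M →ₗ[ℝ] M →ₗ[ℝ] ℝ :=
  have h0 : ∀ u v w : M, Function.update ![u, v] 0 w = ![w, v] := fun u v w => by
    funext i; fin_cases i <;> rfl
  have h1 : ∀ u v w : M, Function.update ![u, v] 1 w = ![u, w] := fun u v w => by
    funext i; fin_cases i <;> rfl
  LinearMap.mk₂ ℝ (fun u v => β ![u, v])
    (fun u u' v => by simpa only [h0] using β.map_update_add ![u, v] 0 u u')
    (fun c u v => by simpa only [h0] using β.map_update_smul ![u, v] 0 c u)
    (fun u v v' => by simpa only [h1] using β.map_update_add ![u, v] 1 v v')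
    (fun c u v => by simpa only [h1] using β.map_update_smul ![u, v] 1 c v)

theorem bilinOfAlternating_apply {M : Type*} [AddCommGroup M] [Module ℝ M] [TopologicalSpace M]
    (β : M [⋀^Fin 2]→L[ℝ] ℝ) (u v : M) : bilinOfAlternating β u v = β ![u, v] := rfl

/-! ### Left-invariant fields -/

section LeftInvariant

variable {n : ℕ} {G : Type*} [TopologicalSpace G] [ChartedSpace (EuclideanSpace ℝ (Fin n)) G]
  [Group G]

theorem mulInvariantVectorField_one (v : GroupLieAlgebra (𝓡 n) G) :
    mulInvariantVectorField v (1 : G) = v := by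
  have h : (fun x : G => (1 : G) * x) = id := by funext x; simp
  unfold mulInvariantVectorField
  rw [h, mfderiv_id]
  rfl

theorem TwoFormField.IsLeftInvariant.apply_mulInvariantVectorField {B : TwoFormField n G}
    (hB : B.IsLeftInvariant) (u v : GroupLieAlgebra (𝓡 n) G) (q : G) :
    B q ![mulInvariantVectorField u q, mulInvariantVectorField v q] = B 1 ![u, v] := by
  rw [← hB q 1 u v]
  -- Forgetting the dependence of the tangent space on the point permits rewriting `q * 1` to `q`.
  let B' : G → (EuclideanSpace ℝ (Fin n) [⋀^Fin 2]→L[ℝ] ℝ) := B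
  have h : B' (q * 1) = B' q := by rw [mul_one]
  exact (congrArg (fun β : EuclideanSpace ℝ (Fin n) [⋀^Fin 2]→L[ℝ] ℝ =>
    β ![mulInvariantVectorField u q, mulInvariantVectorField v q]) h).symm

variable [LieGroup (𝓡 n) ∞ G]

/-- The field is the tangent map of multiplication applied to the zero vector at `g` and `v` at `1`,
a composite of smooth maps. -/
theorem isSmoothField_mulInvariantVectorField (v : GroupLieAlgebra (𝓡 n) G) :
    IsSmoothField (fun q : G => mulInvariantVectorField v q) := by
  let fg : G → TangentBundle (𝓡 n) G := fun g => ⟨g, 0⟩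
  have sfg : ContMDiff (𝓡 n) (𝓡 n).tangent ∞ fg := Bundle.contMDiff_zeroSection _ _
  let fv : G → TangentBundle (𝓡 n) G := fun _ => ⟨1, v⟩
  have sfv : ContMDiff (𝓡 n) (𝓡 n).tangent ∞ fv := contMDiff_const
  have S₂ : ContMDiff ((𝓡 n).tangent.prod (𝓡 n).tangent) ((𝓡 n).prod (𝓡 n)).tangent ∞
      (equivTangentBundleProd (𝓡 n) G (𝓡 n) G).symm := contMDiff_equivTangentBundleProd_symm
  have S₃ : ContMDiff ((𝓡 n).prod (𝓡 n)).tangent (𝓡 n).tangent ∞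
      (tangentMap ((𝓡 n).prod (𝓡 n)) (𝓡 n) (fun p : G × G => p.1 * p.2)) :=
    (contMDiff_mul (𝓡 n) ∞).contMDiff_tangentMap (m := ∞) le_rfl
  have S := (S₃.comp S₂).comp (sfg.prodMk sfv)
  have hM : MDifferentiable ((𝓡 n).prod (𝓡 n)) (𝓡 n) (fun p : G × G => p.1 * p.2) :=
    (contMDiff_mul (𝓡 n) ∞).mdifferentiable (by simp)
  unfold IsSmoothField
  convert! S with g
  · simp [fg, fv]
  · simp only [Function.comp_apply, tangentMap, fg, fv]
    rw [mfderiv_prod_eq_add_apply (hM _)]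
    let T : EuclideanSpace ℝ (Fin n) →L[ℝ] EuclideanSpace ℝ (Fin n) :=
      mfderiv (𝓡 n) (𝓡 n) (fun z : G => z * 1) g
    refine Eq.symm ((congrArg₂ (fun x y : EuclideanSpace ℝ (Fin n) => x + y) T.map_zero ?_).trans
      (zero_add (mulInvariantVectorField v g : EuclideanSpace ℝ (Fin n))))
    rfl

theorem mdifferentiableAt_leftInvariant (v : GroupLieAlgebra (𝓡 n) G) (q : G) :
    MDifferentiableAt (𝓡 n) (𝓡 n).tangent
      (fun g : G => (⟨g, mulInvariantVectorField v g⟩ : TangentBundle (𝓡 n) G)) q :=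
  mdifferentiableAt_mulInvariantVectorField v

theorem mlieBracket_mulInvariantVectorField (u v : GroupLieAlgebra (𝓡 n) G) (q : G) :
    VectorField.mlieBracket (𝓡 n) (fun q => mulInvariantVectorField u q)
      (fun q => mulInvariantVectorField v q) q = mulInvariantVectorField ⁅u, v⁆ q := by
  rw [GroupLieAlgebra.bracket_def, mulInvariantVector_mlieBracket]

/-- The cocycle of a closed left-invariant two-form. -/
theorem exists_twoCocycle (B : TwoFormField n G) (hinv : B.IsLeftInvariant) (hclosed : B.IsClosed) :
    ∃ α : twoCocycle ℝ (GroupLieAlgebra (𝓡 n) G) ℝ, ∀ u v, α.1 u v = B 1 ![u, v] := by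
  let β : GroupLieAlgebra (𝓡 n) G →ₗ[ℝ] GroupLieAlgebra (𝓡 n) G →ₗ[ℝ] ℝ :=
    bilinOfAlternating (B 1)
  have hβ : ∀ u v, β u v = B 1 ![u, v] := fun _ _ => rfl
  let α : twoCochain ℝ (GroupLieAlgebra (𝓡 n) G) ℝ :=
    ⟨β, fun u => (B 1).map_eq_zero_of_eq ![u, u] (i := 0) (j := 1) rfl (by simp)⟩
  have hα : ∀ u v, α u v = B 1 ![u, v] := fun _ _ => rfl
  refine ⟨⟨α, ?_⟩, hα⟩
  rw [mem_twoCocycle_iff]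
  ext u v w
  rw [d₂₃_apply]
  -- On left-invariant fields the functions `B(Y, Z)` are constant, so the derivative terms of `dB`
  -- vanish and the bracket terms are the cocycle identity for the trivial action.
  have h := hclosed _ _ _ (isSmoothField_mulInvariantVectorField u)
    (isSmoothField_mulInvariantVectorField v) (isSmoothField_mulInvariantVectorField w) 1
  simp only [hinv.apply_mulInvariantVectorField, mlieBracket_mulInvariantVectorField] at h
  have hc : ∀ (c : ℝ) (x : GroupLieAlgebra (𝓡 n) G),
      dirDeriv (fun _ : G => c) 1 x = 0 := fun c x => by
    unfold dirDeriv
    rw [mfderiv_const]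
    rfl
  have hz : ∀ (x : GroupLieAlgebra (𝓡 n) G) (r : ℝ), ⁅x, r⁆ = 0 := fun _ _ => rfl
  simp only [hc] at h
  simp only [hz, hα]
  simpa using h

end LeftInvariant

/-! ### Vector fields and brackets in the preferred charts -/

section Chart

open scoped RealInnerProductSpace

variable {n : ℕ} {G : Type*} [TopologicalSpace G] [ChartedSpace (EuclideanSpace ℝ (Fin n)) G]

/-- The representative of a vector field in the preferred chart at `q₀`. -/
noncomputable def chartField (q₀ : G) (X : (q : G) → TangentSpace (𝓡 n) q) :
    EuclideanSpace ℝ (Fin n) → EuclideanSpace ℝ (Fin n) :=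
  VectorField.mpullbackWithin 𝓘(ℝ, EuclideanSpace ℝ (Fin n)) (𝓡 n) (extChartAt (𝓡 n) q₀).symm X
    (Set.range (𝓡 n))

variable [IsManifold (𝓡 n) ∞ G]

theorem isManifold_of_infty (m : ℕ) : IsManifold (𝓡 n) m G :=
  IsManifold.of_le (n := ∞) (by exact_mod_cast le_top)

theorem differentiableAt_chartField {X : (q : G) → TangentSpace (𝓡 n) q} {q₀ : G}
    (hX : MDifferentiableAt (𝓡 n) (𝓡 n).tangent
      (fun q => (⟨q, X q⟩ : TangentBundle (𝓡 n) G)) q₀) :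
    DifferentiableAt ℝ (chartField q₀ X) (extChartAt (𝓡 n) q₀ q₀) := by
  have : IsManifold (𝓡 n) 2 G := isManifold_of_infty 2
  have h : DifferentiableWithinAt ℝ (chartField q₀ X)
      ((extChartAt (𝓡 n) q₀).symm ⁻¹' Set.univ ∩ Set.range (𝓡 n)) (extChartAt (𝓡 n) q₀ q₀) :=
    (mdifferentiableWithinAt_univ.2 hX).differentiableWithinAt_mpullbackWithin_vectorField
  rwa [Set.preimage_univ, Set.univ_inter, ModelWithCorners.range_eq_univ,
    differentiableWithinAt_univ] at h

theorem mfderiv_extChartAt_apply_eq_chartField (X : (q : G) → TangentSpace (𝓡 n) q) {q₀ : G}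
    {y : EuclideanSpace ℝ (Fin n)} (hy : y ∈ (extChartAt (𝓡 n) q₀).target) :
    (mfderiv (𝓡 n) 𝓘(ℝ, EuclideanSpace ℝ (Fin n)) (extChartAt (𝓡 n) q₀)
      ((extChartAt (𝓡 n) q₀).symm y) (X ((extChartAt (𝓡 n) q₀).symm y)) :
        EuclideanSpace ℝ (Fin n)) = chartField q₀ X y := by
  have : IsManifold (𝓡 n) 1 G := isManifold_of_infty 1
  have h := ContinuousLinearMap.inverse_eq
    (mfderivWithin_extChartAt_symm_comp_mfderiv_extChartAt (I := 𝓡 n) hy)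
    (mfderiv_extChartAt_comp_mfderivWithin_extChartAt_symm (I := 𝓡 n) hy)
  unfold chartField
  rw [VectorField.mpullbackWithin_apply, h]
  rfl

/-- The derivative of the preferred chart at its own base point is the identity of the model space,
so no Jacobian appears there. -/
theorem chartField_self (X : (q : G) → TangentSpace (𝓡 n) q) (q₀ : G) :
    chartField q₀ X (extChartAt (𝓡 n) q₀ q₀) = X q₀ := by
  have : IsManifold (𝓡 n) 1 G := isManifold_of_infty 1
  let X' : G → EuclideanSpace ℝ (Fin n) := X
  have h : X' ((extChartAt (𝓡 n) q₀).symm (extChartAt (𝓡 n) q₀ q₀)) = X' q₀ := by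
    rw [extChartAt_to_inv]
  refine Eq.trans ?_ h
  unfold chartField
  rw [VectorField.mpullbackWithin_apply, mfderivWithin_range_extChartAt_symm]
  exact congrArg (fun T : EuclideanSpace ℝ (Fin n) →L[ℝ] EuclideanSpace ℝ (Fin n) =>
    T (X' ((extChartAt (𝓡 n) q₀).symm (extChartAt (𝓡 n) q₀ q₀)))) ContinuousLinearMap.inverse_id

theorem mlieBracket_eq_lieBracket_chartField (X Y : (q : G) → TangentSpace (𝓡 n) q) (q₀ : G) :
    VectorField.mlieBracket (𝓡 n) X Y q₀
      = VectorField.lieBracket ℝ (chartField q₀ X) (chartField q₀ Y)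
          (extChartAt (𝓡 n) q₀ q₀) := by
  have : IsManifold (𝓡 n) 1 G := isManifold_of_infty 1
  rw [← VectorField.mlieBracketWithin_univ, VectorField.mlieBracketWithin_apply,
    mfderiv_extChartAt_self]
  refine (congrArg (fun T : EuclideanSpace ℝ (Fin n) →L[ℝ] EuclideanSpace ℝ (Fin n) => T _)
    ContinuousLinearMap.inverse_id).trans ?_
  change VectorField.lieBracketWithin ℝ (chartField q₀ X) (chartField q₀ Y)
    ((extChartAt (𝓡 n) q₀).symm ⁻¹' Set.univ ∩ Set.range (𝓡 n)) (extChartAt (𝓡 n) q₀ q₀) = _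
  rw [Set.preimage_univ, Set.univ_inter, ModelWithCorners.range_eq_univ,
    VectorField.lieBracketWithin_univ]

theorem coordVector_eq (q : G) (i : Fin n) :
    coordVector q i = (EuclideanSpace.single i 1 : EuclideanSpace ℝ (Fin n)) := by
  have : IsManifold (𝓡 n) 1 G := isManifold_of_infty 1
  unfold coordVector
  rw [mfderiv_extChartAt_self]
  exact congrArg (fun T : EuclideanSpace ℝ (Fin n) →L[ℝ] EuclideanSpace ℝ (Fin n) => T _)
    ContinuousLinearMap.inverse_id

theorem inner_coords_snd (z : Cotangent n G) (v : EuclideanSpace ℝ (Fin n)) :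
    ⟪z.coords.2, v⟫ = z.mom v := by
  let m : EuclideanSpace ℝ (Fin n) →L[ℝ] ℝ := z.mom
  have h1 := sum_inner_single_mul m.toLinearMap v
  refine Eq.trans ?_ h1
  rw [PiLp.inner_apply]
  refine Finset.sum_congr rfl fun i _ => ?_
  have h2 : z.coords.2 i = m (EuclideanSpace.single i 1) := by
    rw [← coordVector_eq z.base i]
    rfl
  rw [h2]
  simp [EuclideanSpace.inner_single_left, mul_comm]

theorem inner_coords_chartField (z : Cotangent n G) (X : (q : G) → TangentSpace (𝓡 n) q) :
    ⟪z.coords.2, chartField z.base X (extChartAt (𝓡 n) z.base z.base)⟫ = z.mom (X z.base) :=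
  (inner_coords_snd z _).trans (congrArg _ (chartField_self X z.base))

theorem inner_coords_lieBracket (z : Cotangent n G) (X Y : (q : G) → TangentSpace (𝓡 n) q) :
    ⟪z.coords.2, VectorField.lieBracket ℝ (chartField z.base X) (chartField z.base Y)
      (extChartAt (𝓡 n) z.base z.base)⟫ = z.mom (VectorField.mlieBracket (𝓡 n) X Y z.base) :=
  (inner_coords_snd z _).trans
    (congrArg _ (mlieBracket_eq_lieBracket_chartField X Y z.base).symm)

theorem leftMomentum_ofCoords [Group G] (b : Module.Basis (Fin n) ℝ (GroupLieAlgebra (𝓡 n) G))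
    (q₀ : G) {y : EuclideanSpace ℝ (Fin n) × EuclideanSpace ℝ (Fin n)}
    (hy : y.1 ∈ (extChartAt (𝓡 n) q₀).target) :
    leftMomentum b (Cotangent.ofCoords q₀ y)
      = fun a => -⟪y.2, chartField q₀ (mulInvariantVectorField (b a)) y.1⟫ := by
  funext a
  rw [← mfderiv_extChartAt_apply_eq_chartField _ hy]
  rfl

/-- The two functions are known to agree only over the chart target; this is a neighbourhood of the
point, which suffices for derivatives. -/
theorem fderiv_comp_leftMomentum_ofCoords [Group G]
    (b : Module.Basis (Fin n) ℝ (GroupLieAlgebra (𝓡 n) G)) (f : (Fin n → ℝ) → ℝ)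
    (z : Cotangent n G) :
    fderiv ℝ (fun y => f (leftMomentum b (Cotangent.ofCoords z.base y))) z.coords
      = fderiv ℝ (fun y => f (fun a =>
          -⟪y.2, chartField z.base (mulInvariantVectorField (b a)) y.1⟫))
        (extChartAt (𝓡 n) z.base z.base, z.coords.2) := by
  refine Filter.EventuallyEq.fderiv_eq ?_
  have h₀ : (extChartAt (𝓡 n) z.base).target ∈ nhds z.coords.1 :=
    extChartAt_target_mem_nhds (I := 𝓡 n) z.base
  have h : Prod.fst ⁻¹' (extChartAt (𝓡 n) z.base).target ∈ nhds z.coords :=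
    continuousAt_fst.preimage_mem_nhds h₀
  filter_upwards [h] with y hy
  rw [leftMomentum_ofCoords b z.base hy]

theorem leftMomentum_eq [Group G] (b : Module.Basis (Fin n) ℝ (GroupLieAlgebra (𝓡 n) G))
    (z : Cotangent n G) :
    leftMomentum b z = fun a => -⟪z.coords.2, chartField z.base (mulInvariantVectorField (b a))
      (extChartAt (𝓡 n) z.base z.base)⟫ := by
  funext a
  rw [inner_coords_chartField]
  rfl

end Chart

/-! ### The left trivialization as a Poisson map -/

section Reduction

variable {n : ℕ} {G : Type*} [TopologicalSpace G] [ChartedSpace (EuclideanSpace ℝ (Fin n)) G]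
  [Group G]

theorem surjective_leftMomentum (b : Module.Basis (Fin n) ℝ (GroupLieAlgebra (𝓡 n) G)) :
    Function.Surjective (leftMomentum b) := by
  intro x
  let b' : Module.Basis (Fin n) ℝ (EuclideanSpace ℝ (Fin n)) := b
  let m : EuclideanSpace ℝ (Fin n) →L[ℝ] ℝ :=
    LinearMap.toContinuousLinearMap (b'.constr ℝ fun i => -x i)
  refine ⟨⟨1, m⟩, ?_⟩
  funext i
  have h : m (b' i) = -x i := b'.constr_basis ℝ _ i
  simp only [leftMomentum, mulInvariantVectorField_one]
  exact (congrArg Neg.neg h).trans (neg_neg _)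

/-- The momentum is linear in `u`. For `u = [b_i, b_j]` the minus sign here cancels the one in `-⟨p,
[E_i, E_j]⟩`, giving `+∑ c_ij^k x_k`. -/
theorem mom_mulInvariantVectorField_sum (b : Module.Basis (Fin n) ℝ (GroupLieAlgebra (𝓡 n) G))
    (z : Cotangent n G) (u : GroupLieAlgebra (𝓡 n) G) :
    z.mom (mulInvariantVectorField u z.base) = -∑ k, b.repr u k * leftMomentum b z k := by
  let ℓ : GroupLieAlgebra (𝓡 n) G →ₗ[ℝ] ℝ :=
    { toFun := fun v => z.mom (mulInvariantVectorField v z.base)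
      map_add' := fun v w => by
        rw [mulInvariantVectorField_add, Pi.add_apply, map_add]
      map_smul' := fun c v => by
        rw [mulInvariantVectorField_smul, Pi.smul_apply, map_smul]
        rfl }
  change ℓ u = _
  conv_lhs => rw [← b.sum_repr u, map_sum]
  rw [← Finset.sum_neg_distrib]
  refine Finset.sum_congr rfl fun k _ => ?_
  rw [map_smul, smul_eq_mul]
  change _ * z.mom (mulInvariantVectorField (b k) z.base) = -(_ * -_)
  ring

variable [LieGroup (𝓡 n) ∞ G]

/-- The left trivialization maps the magnetic bracket to the magnetic Lie–Poisson bracket. -/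
theorem magneticBracket_comp_leftMomentum (b : Module.Basis (Fin n) ℝ (GroupLieAlgebra (𝓡 n) G))
    {B : TwoFormField n G} (hB : B.IsLeftInvariant) {f g : (Fin n → ℝ) → ℝ}
    (hf : Differentiable ℝ f) (hg : Differentiable ℝ g) (z : Cotangent n G) :
    magneticBracket B (fun w => f (leftMomentum b w)) (fun w => g (leftMomentum b w)) z
      = PoissonTensor.bracket
          (fun x => liePoisson b x + Matrix.of fun i j => B 1 ![b i, b j]) f g
          (leftMomentum b z) := by
  let β : EuclideanSpace ℝ (Fin n) →ₗ[ℝ] EuclideanSpace ℝ (Fin n) →ₗ[ℝ] ℝ :=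
    bilinOfAlternating (M := EuclideanSpace ℝ (Fin n)) (B z.base)
  have key := canonical_bracket_comp_momentum (y := extChartAt (𝓡 n) z.base z.base)
    (p := z.coords.2) (V := fun a => chartField z.base (mulInvariantVectorField (b a)))
    (fun a => differentiableAt_chartField (mdifferentiableAt_leftInvariant (b a) z.base)) hf hg β
    (D := fun F => fderiv ℝ (fun y => F (leftMomentum b (Cotangent.ofCoords z.base y))) z.coords)
    (fun F => congrArg _ (fderiv_comp_leftMomentum_ofCoords b F z))
  unfold magneticBracket
  simp only [coordVector_eq]
  refine Eq.trans key ?_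
  simp only [← leftMomentum_eq]
  unfold PoissonTensor.bracket
  refine Finset.sum_congr rfl fun i _ => Finset.sum_congr rfl fun j _ => ?_
  congr 1
  rw [inner_coords_lieBracket, chartField_self, chartField_self]
  have h1 := mom_mulInvariantVectorField_sum b z ⁅b i, b j⁆
  rw [← mlieBracket_mulInvariantVectorField] at h1
  have h2 := hB.apply_mulInvariantVectorField (b i) (b j) z.base
  refine (congrArg₂ (fun x y : ℝ => -x + y) h1 h2).trans ?_
  rw [neg_neg]
  rfl

end Reduction

/-! ### Reduction by left translations and non-integrability of the distribution -/

section Assembly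

variable {n : ℕ} {G : Type*} [TopologicalSpace G] [ChartedSpace (EuclideanSpace ℝ (Fin n)) G]
  [Group G]

theorem TwoFormField.IsLeftInvariant.const_smul {B : TwoFormField n G} (hB : B.IsLeftInvariant)
    (c : ℝ) : TwoFormField.IsLeftInvariant (c • B) := fun g q u v =>
  congrArg (fun r : ℝ => c * r) (hB g q u v)

theorem TwoFormField.isLeftInvariant_zero :
    TwoFormField.IsLeftInvariant (0 : TwoFormField n G) := fun _ _ _ _ => rfl

theorem frameHamiltonian_basis (b : Module.Basis (Fin n) ℝ (GroupLieAlgebra (𝓡 n) G))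
    (z : Cotangent n G) : frameHamiltonian b z = sqHamiltonian n (leftMomentum b z) := by
  simp only [frameHamiltonian, sqHamiltonian, leftMomentum, neg_sq]

/-- Left translation by `q⁻¹` carries the value at `q` to the value at `1`, which is determined by
the basis. -/
theorem exists_basis_apply_ne_zero (b : Module.Basis (Fin n) ℝ (GroupLieAlgebra (𝓡 n) G))
    {B : TwoFormField n G} (hB : B.IsLeftInvariant) (hne : B ≠ 0) :
    ∃ i j, B 1 ![b i, b j] ≠ 0 := by
  by_contra! h
  have h1 : bilinOfAlternating (B 1) = 0 :=
    b.ext fun i => b.ext fun j => h i j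
  have h1' : ∀ u v, B 1 ![u, v] = 0 := fun u v => by
    rw [← bilinOfAlternating_apply, h1]; rfl
  apply hne
  funext q
  ext m
  have hm : m = ![m 0, m 1] := by
    funext i; fin_cases i <;> rfl
  rw [hm, ← hB q⁻¹ q]
  let B' : G → (EuclideanSpace ℝ (Fin n) [⋀^Fin 2]→L[ℝ] ℝ) := B
  have h2 : B' (q⁻¹ * q) = B' 1 := by rw [inv_mul_cancel]
  exact (congrArg (fun β : EuclideanSpace ℝ (Fin n) [⋀^Fin 2]→L[ℝ] ℝ => β _) h2).trans (h1' _ _)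

variable [LieGroup (𝓡 n) ∞ G]

theorem reducesTo_of_isLeftInvariant (b : Module.Basis (Fin n) ℝ (GroupLieAlgebra (𝓡 n) G))
    {B : TwoFormField n G} (hB : B.IsLeftInvariant) {K : Cotangent n G → ℝ}
    {H : (Fin n → ℝ) → ℝ} (hK : ∀ z, K z = H (leftMomentum b z)) {P : PoissonTensor n}
    (hP : ∀ x i j, P x i j = liePoisson b x i j + B 1 ![b i, b j]) :
    ReducesTo b B K P H := by
  refine ⟨fun f g hf hg z => ?_, hK, surjective_leftMomentum b⟩
  rw [magneticBracket_comp_leftMomentum b hB (hf.differentiable (by simp))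
    (hg.differentiable (by simp))]
  unfold PoissonTensor.bracket
  simp only [hP]
  rfl

/-- Involutivity is tested on two frame fields, and their bracket is evaluated at the identity. -/
theorem IsInvolutive.lie_mem_span {ι : Type*} {v : ι → GroupLieAlgebra (𝓡 n) G}
    (h : IsInvolutive (leftDistribution v)) (i j : ι) :
    ⁅v i, v j⁆ ∈ Submodule.span ℝ (Set.range v) := by
  have h1 := h _ _ (isSmoothField_mulInvariantVectorField (v i))
    (isSmoothField_mulInvariantVectorField (v j))
    (fun q => Submodule.subset_span ⟨i, rfl⟩) (fun q => Submodule.subset_span ⟨j, rfl⟩) 1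
  rw [mlieBracket_mulInvariantVectorField] at h1
  unfold leftDistribution at h1
  simpa only [mulInvariantVectorField_one] using h1

end Assembly

theorem snd_eq_zero_of_mem_span_centralBasis {L : Type*} [LieRing L] [LieAlgebra ℝ L] {n : ℕ}
    (b : Module.Basis (Fin n) ℝ L) (α : twoCocycle ℝ L ℝ) {y : LieAlgebra.ofTwoCocycle α}
    (hy : y ∈ Submodule.span ℝ (Set.range fun i : Fin n => centralBasis b α i.castSucc)) :
    y.carrier.2 = 0 := by
  have h : Submodule.span ℝ (Set.range fun i : Fin n => centralBasis b α i.castSucc)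
      ≤ LinearMap.ker ((centralBasis b α).coord (Fin.last n)) := by
    rw [Submodule.span_le]
    rintro _ ⟨i, rfl⟩
    simp
  have := h hy
  rw [LinearMap.mem_ker, Module.Basis.coord_apply, centralBasis_repr] at this
  simpa using this

theorem theorem1 {n : ℕ} {G : Type*} [TopologicalSpace G]
    [ChartedSpace (EuclideanSpace ℝ (Fin n)) G] [Group G] [LieGroup (𝓡 n) ∞ G]
    (b : Module.Basis (Fin n) ℝ (GroupLieAlgebra (𝓡 n) G))
    (B : TwoFormField n G) (hinv : B.IsLeftInvariant) (hclosed : B.IsClosed) :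
    ∃ α : twoCocycle ℝ (GroupLieAlgebra (𝓡 n) G) ℝ,
      -- the cocycle of `B`
      (∀ u v, α.1 u v = B 1 ![u, v]) ∧
      -- the explicit form of the Euler equations on the dual of the central extension
      (∀ x : Fin (n + 1) → ℝ,
        (∀ i : Fin n, (liePoisson (centralBasis b α)).eulerField (extHamiltonian n) x i.castSucc
          = (liePoisson b).eulerField (sqHamiltonian n) (fun j => x j.castSucc) i
            + x (Fin.last n) * ∑ k : Fin n, B 1 ![b i, b k] * x k.castSucc) ∧
        (liePoisson (centralBasis b α)).eulerField (extHamiltonian n) x (Fin.last n) = 0) ∧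
      -- 1) the sub-Riemannian geodesic flow
      ((liePoisson (centralBasis b α)).eulerField (extHamiltonian n)
          = (liePoisson (centralBasis b α)).eulerField (horHamiltonian n) ∧
        ∀ (G' : Type*) [TopologicalSpace G'] [ChartedSpace (EuclideanSpace ℝ (Fin (n + 1))) G']
          [Group G'] [LieGroup (𝓡 (n + 1)) ∞ G']
          (φ : LieAlgebra.ofTwoCocycle α ≃ₗ⁅ℝ⁆ GroupLieAlgebra (𝓡 (n + 1)) G'),
          ReducesTo ((centralBasis b α).map φ.toLinearEquiv) 0
            (frameHamiltonian fun i : Fin (n + 1) => φ (centralBasis b α i))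
            (liePoisson (centralBasis b α)) (extHamiltonian n) ∧
          ReducesTo ((centralBasis b α).map φ.toLinearEquiv) 0
            (frameHamiltonian fun i : Fin n => φ (centralBasis b α i.castSucc))
            (liePoisson (centralBasis b α)) (horHamiltonian n) ∧
          (B ≠ 0 → ¬ IsInvolutive
            (leftDistribution fun i : Fin n => φ (centralBasis b α i.castSucc)))) ∧
      -- 2) the magnetic geodesic flow
      ((∀ c : ℝ, ReducesTo b (c • B) (frameHamiltonian b)
          (magneticLiePoisson b B c) (sqHamiltonian n)) ∧
        ∀ (J : Set ℝ) (γ : ℝ → Fin (n + 1) → ℝ), J.OrdConnected →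
          ((liePoisson (centralBasis b α)).IsSolutionOn (extHamiltonian n) γ J ↔
            ∃ c : ℝ, (∀ t ∈ J, γ t (Fin.last n) = c) ∧
              (magneticLiePoisson b B c).IsSolutionOn (sqHamiltonian n)
                (fun t i => γ t i.castSucc) J)) ∧
      -- 3) integrability
      (∀ k : ℕ, (liePoisson (centralBasis b α)).IsIntegrable (extHamiltonian n) k →
        ∀ᵐ c : ℝ, (magneticLiePoisson b B c).IsIntegrable (sqHamiltonian n) k) := by
  obtain ⟨α, hα⟩ := exists_twoCocycle B hinv hclosed
  have hfam : (liePoisson (centralBasis b α)).IsFamily (magneticLiePoisson b B) := by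
    have h := isFamily_liePoisson_centralBasis b α
    simp only [hα] at h
    exact h
  refine ⟨α, hα, fun x => ⟨fun i => ?_, hfam.eulerField_extHamiltonian_last x⟩,
    ⟨hfam.eulerField_extHamiltonian_eq_horHamiltonian, ?_⟩,
    ⟨fun c => ?_, fun J γ hJ => hfam.isSolutionOn_iff J γ hJ⟩, fun k hk => ?_⟩
  · rw [hfam.eulerField_extHamiltonian_castSucc, eulerField_sqHamiltonian,
      eulerField_sqHamiltonian]
    simp only [magneticLiePoisson, Matrix.add_apply, Matrix.of_apply, add_mul,
      Finset.sum_add_distrib, Finset.mul_sum, mul_assoc]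
  · intro G' _ _ _ _ φ
    have hP : ∀ (x : Fin (n + 1) → ℝ) i j, liePoisson (centralBasis b α) x i j
        = liePoisson ((centralBasis b α).map φ.toLinearEquiv) x i j
          + (0 : TwoFormField (n + 1) G') 1 ![(centralBasis b α).map φ.toLinearEquiv i,
            (centralBasis b α).map φ.toLinearEquiv j] := fun x i j => by
      rw [liePoisson_map]
      exact (add_zero _).symm
    refine ⟨?_, ?_, fun hB hinvol => ?_⟩
    · refine reducesTo_of_isLeftInvariant _ TwoFormField.isLeftInvariant_zero (fun z => ?_) hP
      rw [extHamiltonian_eq, ← frameHamiltonian_basis]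
      rfl
    · refine reducesTo_of_isLeftInvariant _ TwoFormField.isLeftInvariant_zero (fun z => ?_) hP
      simp only [horHamiltonian, frameHamiltonian, sqHamiltonian, leftMomentum, neg_sq]
      rfl
    -- Involutivity would put `[b_i, b_j]` in the span of the horizontal basis vectors, which have
    -- no `w`-component, whereas its `w`-component is `B_ij ≠ 0`.
    · obtain ⟨i, j, hij⟩ := exists_basis_apply_ne_zero b hinv hB
      have h := hinvol.lie_mem_span i j
      rw [← LieEquiv.map_lie, centralBasis_castSucc, centralBasis_castSucc, bracket_ofProd] at h
      have hr : (Set.range fun i : Fin n => φ (centralBasis b α i.castSucc))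
          = (φ.toLinearEquiv : _ →ₗ[ℝ] _) '' Set.range fun i : Fin n => centralBasis b α i.castSucc := by
        rw [← Set.range_comp]
        rfl
      rw [hr, ← Submodule.map_span] at h
      obtain ⟨y, hy, hy'⟩ := h
      have hy₀ := snd_eq_zero_of_mem_span_centralBasis b α hy
      rw [φ.toLinearEquiv.injective hy'] at hy₀
      exact hij ((hα _ _).symm.trans hy₀)
  · refine reducesTo_of_isLeftInvariant b (hinv.const_smul c) (frameHamiltonian_basis b)
      fun x i j => rfl
  · exact hfam.ae_isIntegrable ((contDiff_extHamiltonian n).differentiable (by simp))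
      (r := fun c => c ^ 2 / 2) extHamiltonian_snoc hk
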